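/- A polytope is the convex hull of a non-empty finite subset of $\mathbb{R}^n$; its dimension is that of its affine hull. For a polytope $P \subset \mathbb{R}^n$ and $c \in \mathbb{R}^n$ let $P^c = \{x \in P : \langle c,x\rangle \ge \langle c,y\rangle \text{ for all } y \in P\}$; these sets are the (non-empty) faces of $P$. The normal cone of $P$ at a face $F$ is $N_FP=\{c : F \subseteq P^c\}$ and the normal fan of $P$ is $\{N_FP : F \text{ a face of } P\}$. Polytopes $P,P' \subset \mathbb{R}^n$ are normally equivalent, $P \simeq P'$, if for every $c$ the affine hulls of $P^c$ and $P'^c$ differ by a translation. A polytope is inscribed if all its vertices lie on a common sphere. The inscribed cone of $P$ is $$\mathrm{InCone}(P) = \{P' \simeq P : P' \text{ an inscribed polytope}\}/\text{translations},$$ regarded as a subset of the real vector space of functions on $\mathbb{R}^n$ modulo linear functions, the class of $P'$ being that of its support function $h_{P'}(c)=\max_{x\in P'}\langle c,x\rangle$; $\dim \mathrm{InCone}(P)$ is the dimension of its linear span. $P$ is normally inscribable if $\mathrm{InCone}(P)\neq\emptyset$. A polytope is simplicial if all its facets are simplices; a $2$-face is odd if it has an odd number of vertices; two $2$-faces are adjacent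 if their intersection is an edge. (1) Let $P \subset \mathbb{R}^n$ be a simplicial polytope of dimension $d \ge 3$. Then $\dim \mathrm{InCone}(P) \le 1$. (2) Let $P \subset \mathbb{R}^n$ be a normally inscribable $3$-dimensional polytope. If $P$ has an odd $2$-face, then $\dim \mathrm{InCone}(P) \le 2$. If $P$ has two adjacent odd $2$-faces, then $\dim \mathrm{InCone}(P) = 1$; moreover, up to homothety there is only one inscribed polytope with the same normal fan as $P$: if $Q,Q'$ are two such polytopes, then $Q' = aQ + t$ for some $a > 0$ and $t \in \mathbb{R}^n$. -/

import Mathlib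

open scoped RealInnerProductSpace

noncomputable section

namespace InscribedCone

universe u

variable {E : Type u} [NormedAddCommGroup E] [InnerProductSpace ℝ E]

/-- A (convex) polytope: the convex hull of a non-empty finite set of points. -/
def IsPolytope (P : Set E) : Prop :=
  ∃ s : Set E, s.Finite ∧ s.Nonempty ∧ P = convexHull ℝ s

/-- The dimension of a (non-empty) set: the dimension of its affine hull. -/
def polyDim (P : Set E) : ℕ :=
  Module.finrank ℝ (affineSpan ℝ P).direction

/-- The vertex set of a polytope. -/
def vertices (P : Set E) : Set E :=
  P.extremePoints ℝ

/-- `maxFace P c` is the face `P^c` of `P` on which the linear function `⟪c, ·⟫` is maximal. -/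
def maxFace (P : Set E) (c : E) : Set E :=
  {x | x ∈ P ∧ ∀ y ∈ P, ⟪c, y⟫ ≤ ⟪c, x⟫}

/-- The (non-empty) faces of a polytope `P`, including `P` itself (take `c = 0`). -/
def IsFace (P F : Set E) : Prop :=
  ∃ c : E, F = maxFace P c

/-- The faces of dimension `k`. -/
def IsFaceOfDim (P : Set E) (k : ℕ) (F : Set E) : Prop :=
  IsFace P F ∧ polyDim F = k

/-- The facets: the faces of codimension one. -/
def IsFacet (P F : Set E) : Prop :=
  IsFace P F ∧ polyDim F + 1 = polyDim P

/-- A simplex: the convex hull of a non-empty finite affinely independent set of points. -/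
def IsSimplex (F : Set E) : Prop :=
  ∃ s : Finset E, s.Nonempty ∧ AffineIndependent ℝ ((↑) : s → E) ∧
    F = convexHull ℝ (s : Set E)

/-- A polytope is simplicial if all its facets are simplices. -/
def IsSimplicial (P : Set E) : Prop :=
  ∀ F, IsFacet P F → IsSimplex F

/-- `F` is an odd 2-face of `P`: a two-dimensional face with an odd number of vertices. -/
def IsOddTwoFace (P F : Set E) : Prop :=
  IsFaceOfDim P 2 F ∧ Odd (vertices F).ncard

/-- A polytope is inscribed if all its vertices lie on one sphere. -/
def IsInscribed (P : Set E) : Prop :=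
  ∃ (z : E) (r : ℝ), vertices P ⊆ Metric.sphere z r

/-- Normal equivalence: for every `c` the affine hulls of `P^c` and `Q^c` differ by a
translation. -/
def NormallyEquivalent (P Q : Set E) : Prop :=
  ∀ c : E, (affineSpan ℝ (maxFace P c)).Parallel (affineSpan ℝ (maxFace Q c))

/-- The normal cone `N_F P`. -/
def normalCone (P F : Set E) : Set E :=
  {c | F ⊆ maxFace P c}

/-- The normal fan of `P`: the collection of the normal cones at all (non-empty) faces. -/
def normalFan (P : Set E) : Set (Set E) :=
  {N | ∃ F, IsFace P F ∧ N = normalCone P F}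

/-- The support function `h_P(c) = max {⟪c, x⟫ : x ∈ P}`. -/
def supportFun (P : Set E) : E → ℝ :=
  fun c => sSup ((fun x => ⟪c, x⟫) '' P)

variable (E) in
/-- The space of linear functions `⟪·, t⟫` on `E`. -/
def linearFuns : Submodule ℝ (E → ℝ) where
  carrier := {f | ∃ t : E, f = fun c => ⟪c, t⟫}
  zero_mem' := ⟨0, by funext c; simp⟩
  add_mem' := by
    rintro f g ⟨s, rfl⟩ ⟨t, rfl⟩
    exact ⟨s + t, by funext c; simp [inner_add_right]⟩
  smul_mem' := by
    rintro a f ⟨t, rfl⟩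
    exact ⟨a • t, by funext c; simp [inner_smul_right]⟩

/-- The translation class of a polytope, as the class of its support function modulo linear
functions. A polytope is determined by its support function, Minkowski addition and dilation
by positive numbers are addition and scalar multiplication of support functions, and
`h_{P + t} = h_P + ⟪·, t⟫`. -/
def translationClass (P : Set E) : (E → ℝ) ⧸ linearFuns E :=
  (linearFuns E).mkQ (supportFun P)

/-- The inscribed cone of `P`: the inscribed polytopes that are normally equivalent to `P`,
modulo translations. -/
def inCone (P : Set E) : Set ((E → ℝ) ⧸ linearFuns E) :=
  {q | ∃ Q : Set E, IsPolytope Q ∧ IsInscribed Q ∧ NormallyEquivalent Q P ∧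
    q = translationClass Q}

/-- `P` is normally inscribable if some inscribed polytope is normally equivalent to it. -/
def NormallyInscribable (P : Set E) : Prop :=
  (inCone P).Nonempty

/-- The dimension of the inscribed cone: the dimension of its linear hull (zero if the cone is
empty). -/
def inConeDim (P : Set E) : Cardinal.{u} :=
  Module.rank ℝ (Submodule.span ℝ (inCone P))

end InscribedCone

end

open InscribedCone

/-!
If `Q` is inscribed with center `0` and normally equivalent to `P`, then for every edge `vw` of
`P` the two corresponding vertices of `Q` have equal norm and differ by a multiple of `w - v`;
hence they are exchanged by the reflection `s_{vw}` in the hyperplane orthogonal to `w - v`. The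
vertices of `Q` therefore form a family `y` with `y w = s_{vw} (y v)`. These families form a
vector space, in which a family is determined by its value at a single vertex because the edge
graph is connected.

Around a 2-face all these reflections preserve its plane and reverse the orientation. For two
families `x`, `y` the area form of the projections of `x v` and `y v` to that plane thus changes
sign along every edge, and if the 2-face is odd it vanishes. So the projections to the plane of an
odd 2-face of all families at `v` lie on one line, which costs one dimension; at an edge shared by
two odd 2-faces, the projection of a family to that edge already determines the projection to the
sum of the two planes, which in dimension three is everything.

If `P` is simplicial, an edge of the vertex figure lies in a facet, which is a simplex. In a
triangle the lengths of two edges of `Q` relative to those of `P` agree since the edge vectors add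
up to zero. The vertex figures and the edge graph being connected, this ratio is a global
constant, so `Q` is homothetic to `P`.
-/

noncomputable section

namespace InscribedCone

open Filter Topology Module

variable {E : Type*} [NormedAddCommGroup E] [InnerProductSpace ℝ E] {P Q : Set E}

theorem exists_inner_eq (S : Submodule ℝ E) [FiniteDimensional ℝ S] (f : S →ₗ[ℝ] ℝ) :
    ∃ d ∈ S, ∀ x : S, ⟪d, x⟫ = f x :=
  ⟨(InnerProductSpace.toDual ℝ S).symm f.toContinuousLinearMap, Subtype.coe_prop _,
    fun x => InnerProductSpace.toDual_symm_apply (x := x)⟩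

theorem exists_inner_eq_of_linearIndependent {ι : Type*} [Finite ι] {b : ι → E}
    (hb : LinearIndependent ℝ b) (g : ι → ℝ) : ∃ d : E, ∀ i, ⟪d, b i⟫ = g i := by
  have : FiniteDimensional ℝ (Submodule.span ℝ (Set.range b)) :=
    FiniteDimensional.span_of_finite ℝ (Set.finite_range b)
  obtain ⟨d, -, hd⟩ := exists_inner_eq _ ((Basis.span hb).constr ℝ g)
  refine ⟨d, fun i => ?_⟩
  have hi := hd (Basis.span hb i)
  rwa [Basis.constr_basis, Basis.span_apply] at hi

theorem exists_inner_lt_of_notMem_convexHull {s : Set E} {x : E} (hs : s.Finite)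
    (hx : x ∉ convexHull ℝ s) : ∃ c : E, ∀ y ∈ s, ⟪c, y⟫ < ⟪c, x⟫ := by
  obtain ⟨f, u, hfu, hux⟩ := geometric_hahn_banach_closed_point (convex_convexHull ℝ s)
    (hs.isClosed_convexHull ℝ) hx
  have : FiniteDimensional ℝ (Submodule.span ℝ (insert x s)) :=
    FiniteDimensional.span_of_finite ℝ (hs.insert x)
  obtain ⟨c, -, hc⟩ := exists_inner_eq (Submodule.span ℝ (insert x s))
    (f.toLinearMap.domRestrict _)
  have inner_eq {y : E} (hy : y ∈ insert x s) : ⟪c, y⟫ = f y :=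
    hc ⟨y, Submodule.subset_span hy⟩
  refine ⟨c, fun y hy => ?_⟩
  rw [inner_eq (Set.mem_insert x s), inner_eq (Set.mem_insert_of_mem x hy)]
  exact (hfu y (subset_convexHull ℝ s hy)).trans hux

theorem inner_eq_zero_of_mem_vectorSpan {A : Set E} {d x : E}
    (h : ∀ p ∈ A, ∀ q ∈ A, ⟪d, p⟫ = ⟪d, q⟫) (hx : x ∈ vectorSpan ℝ A) : ⟪d, x⟫ = 0 := by
  have hle : vectorSpan ℝ A ≤ (ℝ ∙ d)ᗮ := by
    rw [vectorSpan_def, Submodule.span_le]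
    rintro _ ⟨p, hp, q, hq, rfl⟩
    simp only [SetLike.mem_coe, Submodule.mem_orthogonal_singleton_iff_inner_right, vsub_eq_sub,
      inner_sub_right, h p hp q hq, sub_self]
  exact Submodule.mem_orthogonal_singleton_iff_inner_right.mp (hle hx)

theorem sub_mem_vectorSpan {A : Set E} {p q : E} (hp : p ∈ A) (hq : q ∈ A) :
    p - q ∈ vectorSpan ℝ A :=
  vsub_mem_vectorSpan ℝ hp hq

theorem eq_singleton_of_vectorSpan_eq_bot {A : Set E} {v : E} (hv : v ∈ A)
    (h : vectorSpan ℝ A = ⊥) : A = {v} :=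
  Set.eq_singleton_iff_unique_mem.mpr
    ⟨hv, fun _ hp => sub_eq_zero.mp ((Submodule.eq_bot_iff _).mp h _ (sub_mem_vectorSpan hp hv))⟩

theorem polyDim_eq (P : Set E) : polyDim P = finrank ℝ (vectorSpan ℝ P) := by
  rw [polyDim, direction_affineSpan]

theorem maxFace_subset (P : Set E) (c : E) : maxFace P c ⊆ P := fun _ hx => hx.1

theorem maxFace_zero (P : Set E) : maxFace P 0 = P := by
  ext x
  simp [maxFace]

theorem inner_eq_of_mem_maxFace {c x y : E} (hx : x ∈ maxFace P c) (hy : y ∈ maxFace P c) :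
    ⟪c, x⟫ = ⟪c, y⟫ :=
  le_antisymm (hy.2 x hx.1) (hx.2 y hy.1)

theorem mem_maxFace_of_inner_le {c x y : E} (hx : x ∈ maxFace P c) (hy : y ∈ P)
    (h : ⟪c, x⟫ ≤ ⟪c, y⟫) : y ∈ maxFace P c :=
  ⟨hy, fun z hz => (hx.2 z hz).trans h⟩

theorem inner_lt_of_notMem_maxFace {c x p : E} (hx : x ∈ maxFace P c) (hp : p ∈ P)
    (hpc : p ∉ maxFace P c) : ⟪c, p⟫ < ⟪c, x⟫ :=
  not_le.mp fun h => hpc (mem_maxFace_of_inner_le hx hp h)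

theorem inner_eq_zero_of_mem_vectorSpan_maxFace {c x : E}
    (hx : x ∈ vectorSpan ℝ (maxFace P c)) : ⟪c, x⟫ = 0 :=
  inner_eq_zero_of_mem_vectorSpan (fun _ hp _ hq => inner_eq_of_mem_maxFace hp hq) hx

theorem maxFace_eq_singleton_iff {c v : E} :
    maxFace P c = {v} ↔ v ∈ P ∧ ∀ p ∈ P, p ≠ v → ⟪c, p⟫ < ⟪c, v⟫ := by
  constructor
  · intro h
    have hv : v ∈ maxFace P c := h ▸ Set.mem_singleton v
    exact ⟨hv.1, fun p hp hpv => inner_lt_of_notMem_maxFace hv hp (h ▸ hpv)⟩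
  · rintro ⟨hv, h⟩
    refine Set.eq_singleton_iff_unique_mem.mpr ⟨⟨hv, fun p hp => ?_⟩, fun p hp => ?_⟩
    · obtain rfl | hpv := eq_or_ne p v
      exacts [le_rfl, (h p hp hpv).le]
    · by_contra hpv
      exact (h p hp.1 hpv).not_ge (hp.2 v hv)

theorem convex_setOf_maxFace_eq_singleton (P : Set E) (v : E) :
    Convex ℝ {c | maxFace P c = {v}} := by
  intro c hc d hd a b ha hb hab
  simp only [Set.mem_ofPred_eq, maxFace_eq_singleton_iff] at hc hd ⊢
  refine ⟨hc.1, fun p hp hpv => ?_⟩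
  have hcp := sub_pos.mpr (hc.2 p hp hpv)
  have hdp := sub_pos.mpr (hd.2 p hp hpv)
  simp only [inner_add_left, real_inner_smul_left]
  rcases ha.eq_or_lt with rfl | ha'
  · simp_all
  · nlinarith [mul_pos ha' hcp, mul_nonneg hb hdp.le]

theorem isExposed_maxFace (P : Set E) (c : E) : IsExposed ℝ P (maxFace P c) :=
  fun _ => ⟨innerSL ℝ c, by simp [maxFace]⟩

theorem vertices_maxFace (P : Set E) (c : E) :
    vertices (maxFace P c) = maxFace P c ∩ vertices P :=
  (isExposed_maxFace P c).isExtreme.extremePoints_eq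

theorem vertices_singleton (v : E) : vertices {v} = {v} :=
  extremePoints_singleton

theorem mem_vertices_of_maxFace_eq {v c : E} (h : maxFace P c = {v}) : v ∈ vertices P := by
  have hv := vertices_maxFace P c
  rw [h, vertices_singleton] at hv
  exact (hv.subset rfl).2

theorem maxFace_convexHull {s T : Set E} {c : E} {r : ℝ} (hne : s.Nonempty) (hsT : s ⊆ T)
    (heq : ∀ p ∈ s, ⟪c, p⟫ = r) (hlt : ∀ p ∈ T, p ∉ s → ⟪c, p⟫ < r) :
    maxFace (convexHull ℝ T) c = convexHull ℝ s := by
  have heq' : ∀ x ∈ convexHull ℝ s, ⟪c, x⟫ = r := fun x hx =>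
    convexHull_min (t := {y | ⟪c, y⟫ = r}) heq
      (convex_hyperplane (innerSL ℝ c).isLinear r) hx
  have hle : ∀ x ∈ {x | ⟪c, x⟫ < r} ∪ convexHull ℝ s, ⟪c, x⟫ ≤ r := fun x hx =>
    hx.elim (fun h => h.le) fun h => (heq' x h).le
  have hconvex : Convex ℝ ({x | ⟪c, x⟫ < r} ∪ convexHull ℝ s) := by
    rw [convex_iff_forall_pos]
    intro x hx y hy a b ha hb hab
    have hval : ⟪c, a • x + b • y⟫ = a * ⟪c, x⟫ + b * ⟪c, y⟫ := by
      simp only [inner_add_right, real_inner_smul_right]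
    have hcomb : a * r + b * r = r := by rw [← add_mul, hab, one_mul]
    have hax := mul_le_mul_of_nonneg_left (hle x hx) ha.le
    have hby := mul_le_mul_of_nonneg_left (hle y hy) hb.le
    rcases hx with hx | hx
    · exact .inl (hval.trans_lt (by linarith [mul_lt_mul_of_pos_left hx.out ha]))
    rcases hy with hy | hy
    · exact .inl (hval.trans_lt (by linarith [mul_lt_mul_of_pos_left hy.out hb]))
    · exact .inr (convex_convexHull ℝ s hx hy ha.le hb.le hab)
  have hsub : convexHull ℝ T ⊆ {x | ⟪c, x⟫ < r} ∪ convexHull ℝ s :=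
    convexHull_min (fun p hp => (em (p ∈ s)).elim
      (fun hps => .inr (subset_convexHull ℝ s hps)) (fun hps => .inl (hlt p hp hps))) hconvex
  refine Set.Subset.antisymm (fun x hx => ?_) (fun x hx => ⟨convexHull_mono hsT hx, ?_⟩)
  · obtain ⟨p, hp⟩ := hne
    have hle := hx.2 p (subset_convexHull ℝ T (hsT hp))
    rw [heq p hp] at hle
    exact (hsub hx.1).resolve_left hle.not_gt
  · intro y hy
    rw [heq' x hx]
    exact hle y (hsub hy)

theorem isPolytope_convexHull {s : Set E} (hs : s.Finite) (hne : s.Nonempty) :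
    IsPolytope (convexHull ℝ s) :=
  ⟨s, hs, hne, rfl⟩

namespace IsPolytope

theorem isCompact (hP : IsPolytope P) : IsCompact P := by
  obtain ⟨s, hs, -, rfl⟩ := hP
  exact hs.isCompact_convexHull ℝ

theorem convex (hP : IsPolytope P) : Convex ℝ P := by
  obtain ⟨s, -, -, rfl⟩ := hP
  exact convex_convexHull ℝ s

theorem nonempty (hP : IsPolytope P) : P.Nonempty := by
  obtain ⟨s, -, hs, rfl⟩ := hP
  exact hs.convexHull

theorem finite_vertices (hP : IsPolytope P) : (vertices P).Finite := by
  obtain ⟨s, hs, -, rfl⟩ := hP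
  exact hs.subset extremePoints_convexHull_subset

theorem finiteDimensional_vectorSpan (hP : IsPolytope P) :
    FiniteDimensional ℝ (vectorSpan ℝ P) := by
  obtain ⟨s, hs, -, rfl⟩ := hP
  rw [← direction_affineSpan, affineSpan_convexHull, direction_affineSpan]
  exact finiteDimensional_vectorSpan_of_finite ℝ hs

theorem convexHull_vertices (hP : IsPolytope P) : convexHull ℝ (vertices P) = P := by
  rw [← (hP.finite_vertices.isClosed_convexHull ℝ).closure_eq]
  exact closure_convexHull_extremePoints hP.isCompact hP.convex

theorem vertices_nonempty (hP : IsPolytope P) : (vertices P).Nonempty := by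
  rw [← convexHull_nonempty_iff (𝕜 := ℝ), hP.convexHull_vertices]
  exact hP.nonempty

theorem maxFace_nonempty (hP : IsPolytope P) (c : E) : (maxFace P c).Nonempty := by
  obtain ⟨x, hx, h⟩ := hP.isCompact.exists_isMaxOn hP.nonempty
    (f := fun y => ⟪c, y⟫) (by fun_prop)
  exact ⟨x, hx, fun y hy => h hy⟩

theorem isPolytope_maxFace (hP : IsPolytope P) (c : E) : IsPolytope (maxFace P c) := by
  have hfin : (vertices (maxFace P c)).Finite := by
    rw [vertices_maxFace]
    exact hP.finite_vertices.inter_of_right _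
  have hhull : convexHull ℝ (vertices (maxFace P c)) = maxFace P c := by
    rw [← (hfin.isClosed_convexHull ℝ).closure_eq]
    exact closure_convexHull_extremePoints ((isExposed_maxFace P c).isCompact hP.isCompact)
      ((isExposed_maxFace P c).convex hP.convex)
  refine ⟨_, hfin, ?_, hhull.symm⟩
  rw [← convexHull_nonempty_iff (𝕜 := ℝ), hhull]
  exact hP.maxFace_nonempty c

theorem vectorSpan_vertices (hP : IsPolytope P) : vectorSpan ℝ (vertices P) = vectorSpan ℝ P := by
  rw [← direction_affineSpan, ← affineSpan_convexHull, hP.convexHull_vertices,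
    direction_affineSpan]

theorem vectorSpan_le (hP : IsPolytope P) {v : E} {M : Submodule ℝ E} (hv : v ∈ vertices P)
    (h : ∀ p ∈ vertices P, p - v ∈ M) : vectorSpan ℝ P ≤ M := by
  rw [← hP.vectorSpan_vertices, vectorSpan_eq_span_vsub_set_right ℝ hv, Submodule.span_le]
  rintro _ ⟨p, hp, rfl⟩
  exact h p hp

theorem maxFace_eq_convexHull (hP : IsPolytope P) {s : Set E} {c : E} {r : ℝ}
    (hne : s.Nonempty) (hs : s ⊆ vertices P) (heq : ∀ p ∈ s, ⟪c, p⟫ = r)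
    (hlt : ∀ p ∈ vertices P, p ∉ s → ⟪c, p⟫ < r) : maxFace P c = convexHull ℝ s := by
  conv_lhs => rw [← hP.convexHull_vertices]
  exact maxFace_convexHull hne hs heq hlt

theorem maxFace_eq_singleton (hP : IsPolytope P) {v c : E} (hv : v ∈ vertices P)
    (h : ∀ p ∈ vertices P, p ≠ v → ⟪c, p⟫ < ⟪c, v⟫) : maxFace P c = {v} := by
  rw [← convexHull_singleton (𝕜 := ℝ) v]
  exact hP.maxFace_eq_convexHull (Set.singleton_nonempty v) (Set.singleton_subset_iff.mpr hv)
    (fun p hp => by rw [Set.mem_singleton_iff.mp hp]) h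

theorem maxFace_eq_singleton_iff (hP : IsPolytope P) {v c : E} :
    maxFace P c = {v} ↔ v ∈ vertices P ∧ ∀ p ∈ vertices P, p ≠ v → ⟪c, p⟫ < ⟪c, v⟫ :=
  ⟨fun h => ⟨mem_vertices_of_maxFace_eq h, fun p hp =>
    (InscribedCone.maxFace_eq_singleton_iff.mp h).2 p hp.1⟩,
    fun h => hP.maxFace_eq_singleton h.1 h.2⟩

theorem isOpen_setOf_maxFace_eq_singleton (hP : IsPolytope P) (v : E) :
    IsOpen {c | maxFace P c = {v}} := by
  simp only [hP.maxFace_eq_singleton_iff, Set.ofPred_and, Set.ofPred_forall]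
  refine isOpen_const.inter <| hP.finite_vertices.isOpen_biInter fun p _ =>
    isOpen_iInter_of_finite fun _ => isOpen_lt (by fun_prop) (by fun_prop)

theorem exists_maxFace_eq_singleton (hP : IsPolytope P) {v : E} (hv : v ∈ vertices P) :
    ∃ c, maxFace P c = {v} := by
  have hv' : v ∉ convexHull ℝ (vertices P \ {v}) := fun h =>
    (hP.convex.mem_extremePoints_iff_mem_sdiff_convexHull_sdiff.mp hv).2
      (convexHull_mono (Set.sdiff_subset_sdiff_left extremePoints_subset) h)
  obtain ⟨c, hc⟩ := exists_inner_lt_of_notMem_convexHull hP.finite_vertices.sdiff hv'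
  exact ⟨c, hP.maxFace_eq_singleton hv fun p hp hpv => hc p ⟨hp, hpv⟩⟩

theorem eventually_maxFace_add (hP : IsPolytope P) (c d : E) :
    ∀ᶠ ε : ℝ in 𝓝[>] 0, maxFace P (c + ε • d) = maxFace (maxFace P c) d := by
  have hF := (hP.isPolytope_maxFace c).isPolytope_maxFace d
  obtain ⟨x, hx⟩ := hF.nonempty
  have hfar : ∀ᶠ ε : ℝ in 𝓝[>] 0, ∀ p ∈ vertices P, p ∉ maxFace P c →
      ⟪c + ε • d, p⟫ < ⟪c + ε • d, x⟫ := by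
    rw [eventually_all_finite hP.finite_vertices]
    intro p hp
    rw [eventually_imp_distrib_left]
    intro hpc
    have hlt := inner_lt_of_notMem_maxFace hx.1 hp.1 hpc
    refine nhdsWithin_le_nhds (ContinuousAt.eventually_lt ?_ ?_ (by simpa using hlt)) <;> fun_prop
  filter_upwards [hfar, self_mem_nhdsWithin] with ε hfar hε
  have inner_perturb (p : E) (hp : p ∈ maxFace P c) :
      ⟪c + ε • d, p⟫ = ⟪c, x⟫ + ε * ⟪d, p⟫ := by
    rw [inner_add_left, real_inner_smul_left, inner_eq_of_mem_maxFace hp hx.1]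
  rw [← hF.convexHull_vertices]
  refine hP.maxFace_eq_convexHull hF.vertices_nonempty ?_ (r := ⟪c + ε • d, x⟫) ?_ ?_
  · rw [vertices_maxFace, vertices_maxFace]
    exact fun p hp => hp.2.2
  · intro p hp
    rw [inner_perturb p hp.1.1, inner_perturb x hx.1, inner_eq_of_mem_maxFace hp.1 hx]
  · intro p hp hps
    by_cases hpc : p ∈ maxFace P c
    · rw [vertices_maxFace, vertices_maxFace] at hps
      have hlt := inner_lt_of_notMem_maxFace hx hpc fun h => hps ⟨h, hpc, hp⟩
      rw [inner_perturb p hpc, inner_perturb x hx.1]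
      exact add_lt_add_right (mul_lt_mul_of_pos_left hlt hε) _
    · exact hfar p hp hpc

end IsPolytope

theorem eq_or_eq_of_collinear {u v w : E} (hu : u ∈ vertices P) (hv : v ∈ vertices P)
    (hw : w ∈ vertices P) (huv : u ≠ v) (h : Collinear ℝ {u, v, w}) : w = u ∨ w = v := by
  have key {x y z : E} (hx : x ∈ P) (hy : y ∈ vertices P) (hz : z ∈ P) (hxyz : Wbtw ℝ x y z) :
      x = y ∨ z = y :=
    (mem_extremePoints_iff_forall_segment.mp hy).2 x hx z hz (mem_segment_iff_wbtw.mpr hxyz)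
  rcases h.wbtw_or_wbtw_or_wbtw with h | h | h
  · exact (key hu.1 hv hw.1 h).elim (absurd · huv) .inr
  · exact (key hv.1 hw hu.1 h).elim (.inr ·.symm) (.inl ·.symm)
  · exact (key hw.1 hu hv.1 h).elim .inl (absurd ·.symm huv)

theorem NormallyEquivalent.vectorSpan_eq (h : NormallyEquivalent Q P) (c : E) :
    vectorSpan ℝ (maxFace Q c) = vectorSpan ℝ (maxFace P c) := by
  simpa only [direction_affineSpan] using (h c).direction_eq

/-- Two distinct vertices of `P` whose convex hull is a face of `P`. -/
def IsEdge (P : Set E) (v w : E) : Prop :=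
  v ≠ w ∧ v ∈ vertices P ∧ w ∈ vertices P ∧ ∃ c, maxFace P c = convexHull ℝ {v, w}

theorem IsEdge.symm {v w : E} (h : IsEdge P v w) : IsEdge P w v := by
  obtain ⟨hvw, hv, hw, c, hc⟩ := h
  exact ⟨hvw.symm, hw, hv, c, by rw [hc, Set.pair_comm]⟩

theorem IsPolytope.isEdge_of_isEdge_maxFace (hP : IsPolytope P) {c v w : E}
    (h : IsEdge (maxFace P c) v w) : IsEdge P v w := by
  obtain ⟨hvw, hv, hw, d, hd⟩ := h
  rw [vertices_maxFace] at hv hw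
  obtain ⟨ε, hε⟩ := (hP.eventually_maxFace_add c d).exists
  exact ⟨hvw, hv.2, hw.2, _, hε.trans hd⟩

/-- The point where the ray from `v` through `p` meets the hyperplane `⟪b, x - v⟫ = -1`, relative
to the origin `v`. -/
def figurePoint (b v p : E) : E :=
  ⟪b, v - p⟫⁻¹ • (p - v)

/-- The vertex figure of `P` at `v`: the section of the cone of `P` at `v` by the hyperplane
`⟪b, x - v⟫ = -1`, where `b` exposes the vertex `v`. -/
def vertexFigure (P : Set E) (b v : E) : Set E :=
  convexHull ℝ (figurePoint b v '' (vertices P \ {v}))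

section VertexFigure

variable {b v p w : E}

theorem figurePoint_mem_vertexFigure (hp : p ∈ vertices P) (hpv : p ≠ v) :
    figurePoint b v p ∈ vertexFigure P b v :=
  subset_convexHull ℝ _ ⟨p, ⟨hp, hpv⟩, rfl⟩

theorem exists_figurePoint_eq {q : E} (hq : q ∈ vertices (vertexFigure P b v)) :
    ∃ p ∈ vertices P, p ≠ v ∧ figurePoint b v p = q := by
  obtain ⟨p, hp, rfl⟩ := extremePoints_convexHull_subset hq
  exact ⟨p, hp.1, hp.2, rfl⟩

theorem IsPolytope.isPolytope_vertexFigure (hP : IsPolytope P) (b : E) (hp : p ∈ vertices P)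
    (hpv : p ≠ v) : IsPolytope (vertexFigure P b v) :=
  isPolytope_convexHull (hP.finite_vertices.sdiff.image _) ⟨_, p, ⟨hp, hpv⟩, rfl⟩

theorem inner_sub_pos_of_maxFace_eq (hb : maxFace P b = {v}) (hp : p ∈ P) (hpv : p ≠ v) :
    0 < ⟪b, v - p⟫ := by
  rw [inner_sub_right, sub_pos]
  exact (maxFace_eq_singleton_iff.mp hb).2 p hp hpv

theorem smul_figurePoint (hb : maxFace P b = {v}) (hp : p ∈ P) (hpv : p ≠ v) :
    ⟪b, v - p⟫ • figurePoint b v p = p - v :=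
  smul_inv_smul₀ (inner_sub_pos_of_maxFace_eq hb hp hpv).ne' _

theorem inner_sub_eq_mul_inner_figurePoint (hb : maxFace P b = {v}) (hp : p ∈ P) (hpv : p ≠ v)
    (c : E) : ⟪c, p⟫ - ⟪c, v⟫ = ⟪b, v - p⟫ * ⟪c, figurePoint b v p⟫ := by
  rw [← inner_sub_right, ← smul_figurePoint hb hp hpv, real_inner_smul_right]

theorem figurePoint_injOn (hb : maxFace P b = {v}) :
    Set.InjOn (figurePoint b v) (vertices P \ {v}) := by
  rintro p ⟨hp, hpv⟩ w ⟨hw, hwv⟩ h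
  have hcol : Collinear ℝ {v, w, p} := by
    rw [collinear_iff_of_mem (Set.mem_insert v _)]
    refine ⟨figurePoint b v p, ?_⟩
    simp only [Set.mem_insert_iff, Set.mem_singleton_iff, forall_eq_or_imp, forall_eq,
      vadd_eq_add]
    refine ⟨⟨0, by rw [zero_smul, zero_add]⟩, ⟨⟪b, v - w⟫, ?_⟩, ⟨⟪b, v - p⟫, ?_⟩⟩
    · rw [h, smul_figurePoint hb hw.1 hwv, sub_add_cancel]
    · rw [smul_figurePoint hb hp.1 hpv, sub_add_cancel]
  exact (eq_or_eq_of_collinear (mem_vertices_of_maxFace_eq hb) hw hp (Ne.symm hwv)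
    hcol).resolve_left hpv

theorem IsPolytope.maxFace_add_smul_of_mem_vertexFigure (hP : IsPolytope P) {f q : E}
    (hb : maxFace P b = {v}) (hq : q ∈ maxFace (vertexFigure P b v) f) :
    maxFace P (f + ⟪f, q⟫ • b) = convexHull ℝ (insert v {p | p ∈ vertices P ∧ p ≠ v ∧
      figurePoint b v p ∈ maxFace (vertexFigure P b v) f}) := by
  have hv := mem_vertices_of_maxFace_eq hb
  have inner_diff {p : E} (hp : p ∈ vertices P) (hpv : p ≠ v) :
      ⟪f + ⟪f, q⟫ • b, p⟫ - ⟪f + ⟪f, q⟫ • b, v⟫ =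
        ⟪b, v - p⟫ * (⟪f, figurePoint b v p⟫ - ⟪f, q⟫) := by
    have hf := inner_sub_eq_mul_inner_figurePoint hb hp.1 hpv f
    simp only [inner_add_left, inner_sub_right, real_inner_smul_left] at hf ⊢
    linear_combination hf
  refine hP.maxFace_eq_convexHull (Set.insert_nonempty v _) ?_ (r := ⟪f + ⟪f, q⟫ • b, v⟫) ?_ ?_
  · exact Set.insert_subset hv fun p hp => hp.1
  · rintro p (rfl | ⟨hp, hpv, hpf⟩)
    · rfl
    rw [← sub_eq_zero, inner_diff hp hpv, inner_eq_of_mem_maxFace hpf hq, sub_self, mul_zero]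
  · intro p hp hps
    have hpv : p ≠ v := fun h => hps (.inl h)
    have hlt := inner_lt_of_notMem_maxFace hq (figurePoint_mem_vertexFigure hp hpv)
      fun h => hps (.inr ⟨hp, hpv, h⟩)
    rw [← sub_neg, inner_diff hp hpv]
    exact mul_neg_of_pos_of_neg (inner_sub_pos_of_maxFace_eq hb hp.1 hpv) (sub_neg.mpr hlt)

theorem IsPolytope.isEdge_of_figurePoint_mem_vertices (hP : IsPolytope P)
    (hb : maxFace P b = {v}) (hw : w ∈ vertices P) (hwv : w ≠ v)
    (hq : figurePoint b v w ∈ vertices (vertexFigure P b v)) : IsEdge P v w := by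
  obtain ⟨f, hf⟩ := (hP.isPolytope_vertexFigure b hw hwv).exists_maxFace_eq_singleton hq
  refine ⟨hwv.symm, mem_vertices_of_maxFace_eq hb, hw, f + ⟪f, figurePoint b v w⟫ • b, ?_⟩
  rw [hP.maxFace_add_smul_of_mem_vertexFigure hb (hf ▸ Set.mem_singleton _), hf]
  congr 2
  ext p
  constructor
  · rintro ⟨hp, hpv, hpw⟩
    exact figurePoint_injOn hb ⟨hp, hpv⟩ ⟨hw, hwv⟩ hpw
  · rintro rfl
    exact ⟨hw, hwv, rfl⟩

end VertexFigure

theorem IsPolytope.exists_vertex_inner_lt (hP : IsPolytope P) {v c : E} (hv : v ∈ P)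
    (hc : v ∉ maxFace P c) : ∃ p ∈ vertices P, ⟪c, v⟫ < ⟪c, p⟫ := by
  obtain ⟨p, hp⟩ := (hP.isPolytope_maxFace c).vertices_nonempty
  rw [vertices_maxFace] at hp
  exact ⟨p, hp.2, inner_lt_of_notMem_maxFace hp.1 hv hc⟩

/-- The simplex method: at a vertex that is not optimal there is an improving edge. -/
theorem IsPolytope.exists_isEdge_inner_lt (hP : IsPolytope P) {v c : E} (hv : v ∈ vertices P)
    (hc : v ∉ maxFace P c) : ∃ w, IsEdge P v w ∧ ⟪c, v⟫ < ⟪c, w⟫ := by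
  obtain ⟨b, hb⟩ := hP.exists_maxFace_eq_singleton hv
  obtain ⟨p, hp, hpc⟩ := hP.exists_vertex_inner_lt hv.1 hc
  have hpv : p ≠ v := fun h => hpc.ne' (by rw [h])
  obtain ⟨q, hq⟩ := ((hP.isPolytope_vertexFigure b hp hpv).isPolytope_maxFace c).vertices_nonempty
  rw [vertices_maxFace] at hq
  obtain ⟨w, hw, hwv, rfl⟩ := exists_figurePoint_eq hq.2
  refine ⟨w, hP.isEdge_of_figurePoint_mem_vertices hb hw hwv hq.2, ?_⟩
  have hp_pos : 0 < ⟪c, figurePoint b v p⟫ := by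
    rw [← sub_pos, inner_sub_eq_mul_inner_figurePoint hb hp.1 hpv] at hpc
    exact pos_of_mul_pos_right hpc (inner_sub_pos_of_maxFace_eq hb hp.1 hpv).le
  rw [← sub_pos, inner_sub_eq_mul_inner_figurePoint hb hw.1 hwv]
  exact mul_pos (inner_sub_pos_of_maxFace_eq hb hw.1 hwv)
    (hp_pos.trans_le (hq.1.2 _ (figurePoint_mem_vertexFigure hp hpv)))

theorem IsPolytope.induction_on_edges (hP : IsPolytope P) {S : E → Prop} {v₀ w : E}
    (hv₀ : v₀ ∈ vertices P) (h₀ : S v₀) (h : ∀ v w, IsEdge P v w → S v → S w)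
    (hw : w ∈ vertices P) : S w := by
  obtain ⟨c, hc⟩ := hP.exists_maxFace_eq_singleton hw
  obtain ⟨v, ⟨hv, hSv⟩, hmax⟩ := Set.exists_max_image {v | v ∈ vertices P ∧ S v} (fun v => ⟪c, v⟫)
    (hP.finite_vertices.subset fun _ h => h.1) ⟨v₀, hv₀, h₀⟩
  by_cases hvc : v ∈ maxFace P c
  · rw [hc] at hvc
    rwa [← Set.mem_singleton_iff.mp hvc]
  · obtain ⟨u, hu, hlt⟩ := hP.exists_isEdge_inner_lt hv hvc
    exact absurd hlt (hmax u ⟨hu.2.2.1, h v u hu hSv⟩).not_gt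

theorem IsPolytope.exists_isEdge (hP : IsPolytope P) {v p : E} (hv : v ∈ vertices P)
    (hp : p ∈ P) (hpv : p ≠ v) : ∃ w, IsEdge P v w := by
  obtain ⟨w, hw, -⟩ := hP.exists_isEdge_inner_lt hv (c := p - v) fun h => by
    have hle := h.2 p hp
    rw [← sub_nonpos, ← inner_sub_right, real_inner_self_nonpos, sub_eq_zero] at hle
    exact hpv hle
  exact ⟨w, hw⟩

/-- The vertex of `Q` that is exposed by the functionals exposing the vertex `v` of `P`; an
arbitrary point if no functional exposes `v` on `P` and a vertex on `Q`. -/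
def vertexMap (P Q : Set E) (v : E) : E :=
  Classical.epsilon fun u => ∃ c, maxFace P c = {v} ∧ maxFace Q c = {u}

theorem vectorSpan_convexHull_pair (v w : E) :
    vectorSpan ℝ (convexHull ℝ {v, w}) = ℝ ∙ (w - v) := by
  rw [← direction_affineSpan, affineSpan_convexHull, direction_affineSpan, vectorSpan_pair_rev,
    vsub_eq_sub]

theorem maxFace_convexHull_pair {v w d : E} (h : ⟪d, v⟫ < ⟪d, w⟫) :
    maxFace (convexHull ℝ {v, w}) d = {w} := by
  have hlt : ∀ p ∈ ({v, w} : Set E), p ∉ ({w} : Set E) → ⟪d, p⟫ < ⟪d, w⟫ := by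
    rintro p (rfl | hp) hpw
    exacts [h, absurd hp hpw]
  rw [maxFace_convexHull (Set.singleton_nonempty w) (by simp) (by simp) hlt, convexHull_singleton]

theorem maxFace_convexHull_pair_sub {v w : E} (h : v ≠ w) :
    maxFace (convexHull ℝ {v, w}) (w - v) = {w} := by
  apply maxFace_convexHull_pair
  rw [← sub_pos, ← inner_sub_right, real_inner_self_pos]
  exact sub_ne_zero.mpr h.symm

namespace NormallyEquivalent

theorem symm (h : NormallyEquivalent Q P) : NormallyEquivalent P Q :=
  fun c => (h c).symm

theorem exists_maxFace_eq_singleton (h : NormallyEquivalent Q P) (hQ : IsPolytope Q)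
    {c v : E} (hc : maxFace P c = {v}) : ∃ u, maxFace Q c = {u} := by
  obtain ⟨u, hu⟩ := hQ.maxFace_nonempty c
  refine ⟨u, eq_singleton_of_vectorSpan_eq_bot hu ?_⟩
  rw [h.vectorSpan_eq c, hc, vectorSpan_singleton]

/-- The functionals exposing `v` on `P` form a connected set, which is covered by the disjoint open
sets of functionals exposing the various vertices of `Q`. -/
theorem maxFace_eq_of_maxFace_eq (h : NormallyEquivalent Q P) (hQ : IsPolytope Q)
    {c d v u : E} (hc : maxFace P c = {v}) (hd : maxFace P d = {v}) (hu : maxFace Q c = {u}) :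
    maxFace Q d = {u} := by
  let others : Set E := ⋃ u' ≠ u, {c | maxFace Q c = {u'}}
  have others_open : IsOpen others :=
    isOpen_biUnion fun u' _ => hQ.isOpen_setOf_maxFace_eq_singleton u'
  have hdisj : Disjoint {c | maxFace Q c = {u}} others := by
    simp only [others, Set.disjoint_iUnion_right]
    exact fun u' hu' => Set.disjoint_left.mpr fun c hcu hcu' =>
      hu' (Set.singleton_injective (hcu'.out.symm.trans hcu))
  have hcover : {c | maxFace P c = {v}} ⊆ {c | maxFace Q c = {u}} ∪ others := by
    intro b hb
    obtain ⟨u', hu'⟩ := h.exists_maxFace_eq_singleton hQ hb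
    obtain rfl | hne := eq_or_ne u' u
    · exact .inl hu'
    · exact .inr (Set.mem_biUnion (x := u') hne hu')
  exact (convex_setOf_maxFace_eq_singleton P v).isPreconnected.subset_left_of_subset_union
    (hQ.isOpen_setOf_maxFace_eq_singleton u) others_open hdisj hcover ⟨c, hc, hu⟩ hd

theorem maxFace_eq_vertexMap (h : NormallyEquivalent Q P) (hQ : IsPolytope Q)
    {c v : E} (hc : maxFace P c = {v}) : maxFace Q c = {vertexMap P Q v} := by
  have hex : ∃ u c, maxFace P c = {v} ∧ maxFace Q c = {u} :=
    (h.exists_maxFace_eq_singleton hQ hc).imp fun u hu => ⟨c, hc, hu⟩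
  obtain ⟨d, hd, hd'⟩ := Classical.epsilon_spec hex
  exact h.maxFace_eq_of_maxFace_eq hQ hd hc hd'

theorem maxFace_maxFace_eq_vertexMap (h : NormallyEquivalent Q P) (hP : IsPolytope P)
    (hQ : IsPolytope Q) {c d v : E} (hv : maxFace (maxFace P c) d = {v}) :
    maxFace (maxFace Q c) d = {vertexMap P Q v} := by
  obtain ⟨ε, hεP, hεQ⟩ := ((hP.eventually_maxFace_add c d).and
    (hQ.eventually_maxFace_add c d)).exists
  rw [← hεQ]
  exact h.maxFace_eq_vertexMap hQ (hεP.trans hv)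

theorem vertexMap_mem_maxFace (h : NormallyEquivalent Q P) (hP : IsPolytope P)
    (hQ : IsPolytope Q) {c v : E} (hv : v ∈ vertices P) (hc : v ∈ maxFace P c) :
    vertexMap P Q v ∈ maxFace Q c := by
  obtain ⟨d, hd⟩ := (hP.isPolytope_maxFace c).exists_maxFace_eq_singleton (v := v)
    (by rw [vertices_maxFace]; exact ⟨hc, hv⟩)
  exact maxFace_subset _ d (h.maxFace_maxFace_eq_vertexMap hP hQ hd ▸ Set.mem_singleton _)

theorem vertices_eq (h : NormallyEquivalent Q P) (hP : IsPolytope P) (hQ : IsPolytope Q) :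
    vertices Q = vertexMap P Q '' vertices P := by
  ext u
  constructor
  · intro hu
    obtain ⟨c, hc⟩ := hQ.exists_maxFace_eq_singleton hu
    obtain ⟨v, hv⟩ := h.symm.exists_maxFace_eq_singleton hP hc
    refine ⟨v, mem_vertices_of_maxFace_eq hv, Set.singleton_injective ?_⟩
    rw [← h.maxFace_eq_vertexMap hQ hv, hc]
  · rintro ⟨v, hv, rfl⟩
    obtain ⟨c, hc⟩ := hP.exists_maxFace_eq_singleton hv
    exact mem_vertices_of_maxFace_eq (h.maxFace_eq_vertexMap hQ hc)

theorem exists_vertexMap_sub (h : NormallyEquivalent Q P) (hP : IsPolytope P)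
    (hQ : IsPolytope Q) {v w : E} (hvw : IsEdge P v w) :
    ∃ μ : ℝ, 0 < μ ∧ vertexMap P Q w - vertexMap P Q v = μ • (w - v) := by
  obtain ⟨hne, -, -, c, hc⟩ := hvw
  have hmax : maxFace (maxFace Q c) (w - v) = {vertexMap P Q w} :=
    h.maxFace_maxFace_eq_vertexMap hP hQ (hc ▸ maxFace_convexHull_pair_sub hne)
  have hmin : maxFace (maxFace Q c) (v - w) = {vertexMap P Q v} :=
    h.maxFace_maxFace_eq_vertexMap hP hQ
      (by rw [hc, Set.pair_comm]; exact maxFace_convexHull_pair_sub hne.symm)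
  have hspan : vectorSpan ℝ (maxFace Q c) = ℝ ∙ (w - v) := by
    rw [h.vectorSpan_eq, hc, vectorSpan_convexHull_pair]
  have hv' : vertexMap P Q v ∈ maxFace Q c :=
    maxFace_subset _ _ (hmin ▸ Set.mem_singleton _)
  have hw' : vertexMap P Q w ∈ maxFace Q c :=
    maxFace_subset _ _ (hmax ▸ Set.mem_singleton _)
  have hne' : vertexMap P Q v ≠ vertexMap P Q w := by
    intro heq
    have hsingle : maxFace Q c = {vertexMap P Q w} := by
      refine Set.eq_singleton_iff_unique_mem.mpr ⟨hw', fun p hp => ?_⟩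
      by_contra hpw
      have hlt := (maxFace_eq_singleton_iff.mp hmax).2 p hp hpw
      have hgt := (maxFace_eq_singleton_iff.mp hmin).2 p hp (heq ▸ hpw)
      rw [← neg_sub, inner_neg_left, inner_neg_left, neg_lt_neg_iff, heq] at hgt
      exact hlt.not_gt hgt
    rw [hsingle, vectorSpan_singleton, eq_comm, Submodule.span_singleton_eq_bot, sub_eq_zero]
      at hspan
    exact hne hspan.symm
  obtain ⟨μ, hμ⟩ := Submodule.mem_span_singleton.mp (hspan ▸ sub_mem_vectorSpan hw' hv')
  refine ⟨μ, ?_, hμ.symm⟩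
  have hpos := sub_pos.mpr ((maxFace_eq_singleton_iff.mp hmax).2 _ hv' hne')
  rw [← inner_sub_right, ← hμ, real_inner_smul_right] at hpos
  exact pos_of_mul_pos_left hpos real_inner_self_nonneg

end NormallyEquivalent

theorem IsPolytope.exists_vertex_ne (hP : IsPolytope P) (h : vectorSpan ℝ P ≠ ⊥) (v : E) :
    ∃ p ∈ vertices P, p ≠ v := by
  by_contra! hv
  have hle := vectorSpan_mono ℝ (Set.subset_singleton_iff.mpr hv)
  rw [hP.vectorSpan_vertices, vectorSpan_singleton, le_bot_iff] at hle
  exact h hle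

theorem even_card_of_comp_eq_neg {α : Type*} {s : Finset α} {σ : α → α} {D : α → ℝ}
    (hmaps : Set.MapsTo σ s s) (hinj : Set.InjOn σ s) (hneg : ∀ v ∈ s, D (σ v) = -D v)
    (hne : ∀ v ∈ s, D v ≠ 0) : Even s.card := by
  have hprod : ∏ v ∈ s, D (σ v) = ∏ v ∈ s, D v :=
    Finset.prod_nbij σ hmaps hinj (Finset.surjOn_of_injOn_of_card_le σ hmaps hinj le_rfl)
      fun _ _ => rfl
  rw [Finset.prod_congr rfl hneg, Finset.prod_neg] at hprod
  refine (neg_one_pow_eq_one_iff_even (R := ℝ) (by norm_num)).mp ?_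
  exact mul_right_cancel₀ (Finset.prod_ne_zero_iff.mpr hne) (hprod.trans (one_mul _).symm)

theorem reflection_orthogonal_singleton_apply (e x : E) :
    (ℝ ∙ e)ᗮ.reflection x = x - (2 * (⟪e, x⟫ / ⟪e, e⟫)) • e := by
  rw [Submodule.reflection_orthogonal_apply, Submodule.reflection_singleton_apply,
    real_inner_self_eq_norm_sq, RCLike.ofReal_real_eq_id, id, neg_sub, ← Nat.cast_smul_eq_nsmul ℝ,
    smul_smul, Nat.cast_ofNat]

/-- The alternating form `a₁ ∧ a₂`, which orients the plane spanned by `a₁` and `a₂`. -/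
def planeForm (a₁ a₂ x y : E) : ℝ :=
  ⟪a₁, x⟫ * ⟪a₂, y⟫ - ⟪a₂, x⟫ * ⟪a₁, y⟫

section PlaneForm

variable {a₁ a₂ x y : E}

theorem planeForm_swap (a₁ a₂ x y : E) : planeForm a₁ a₂ y x = -planeForm a₁ a₂ x y := by
  simp only [planeForm]
  ring

theorem eq_zero_of_mem_span_pair (hx : x ∈ Submodule.span ℝ {a₁, a₂}) (h₁ : ⟪a₁, x⟫ = 0)
    (h₂ : ⟪a₂, x⟫ = 0) : x = 0 := by
  obtain ⟨s, t, hst⟩ := Submodule.mem_span_pair.mp hx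
  rw [← inner_self_eq_zero (𝕜 := ℝ)]
  nth_rewrite 1 [← hst]
  simp only [inner_add_left, real_inner_smul_left, h₁, h₂, mul_zero, add_zero]

theorem planeForm_cyclic {z : E} (hx : x ∈ Submodule.span ℝ {a₁, a₂})
    (hy : y ∈ Submodule.span ℝ {a₁, a₂}) (hz : z ∈ Submodule.span ℝ {a₁, a₂}) :
    planeForm a₁ a₂ x y • z + planeForm a₁ a₂ y z • x + planeForm a₁ a₂ z x • y = 0 := by
  have hmem := add_mem (add_mem (Submodule.smul_mem _ (planeForm a₁ a₂ x y) hz)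
    (Submodule.smul_mem _ (planeForm a₁ a₂ y z) hx))
    (Submodule.smul_mem _ (planeForm a₁ a₂ z x) hy)
  refine eq_zero_of_mem_span_pair hmem ?_ ?_ <;>
  · simp only [inner_add_right, real_inner_smul_right, planeForm]
    ring

theorem exists_eq_smul_of_planeForm_eq_zero (hx : x ∈ Submodule.span ℝ {a₁, a₂})
    (hy : y ∈ Submodule.span ℝ {a₁, a₂}) (hx0 : x ≠ 0) (h : planeForm a₁ a₂ x y = 0) :
    ∃ r : ℝ, y = r • x := by
  rw [planeForm] at h
  obtain ⟨s, t, hst⟩ := Submodule.mem_span_pair.mp hx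
  have inner_x (z : E) : ⟪x, z⟫ = s * ⟪a₁, z⟫ + t * ⟪a₂, z⟫ := by
    rw [← hst, inner_add_left, real_inner_smul_left, real_inner_smul_left]
  have hzero : ⟪x, x⟫ • y - ⟪x, y⟫ • x = 0 := by
    refine eq_zero_of_mem_span_pair (sub_mem (Submodule.smul_mem _ _ hy)
      (Submodule.smul_mem _ _ hx)) ?_ ?_ <;>
      rw [inner_sub_right, real_inner_smul_right, real_inner_smul_right, inner_x x, inner_x y]
    · linear_combination -t * h
    · linear_combination s * h
  refine ⟨⟪x, x⟫⁻¹ * ⟪x, y⟫, ?_⟩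
  rw [mul_smul, ← sub_eq_zero.mp hzero, inv_smul_smul₀ (inner_self_ne_zero.mpr hx0)]

theorem planeForm_reflection {e : E} (he : e ∈ Submodule.span ℝ {a₁, a₂}) (he0 : e ≠ 0) :
    planeForm a₁ a₂ ((ℝ ∙ e)ᗮ.reflection x) ((ℝ ∙ e)ᗮ.reflection y) =
      -planeForm a₁ a₂ x y := by
  have hne : ⟪e, e⟫ ≠ 0 := inner_self_ne_zero.mpr he0
  obtain ⟨s, t, hst⟩ := Submodule.mem_span_pair.mp he
  have inner_e (z : E) : ⟪e, z⟫ = s * ⟪a₁, z⟫ + t * ⟪a₂, z⟫ := by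
    rw [← hst, inner_add_left, real_inner_smul_left, real_inner_smul_left]
  simp only [reflection_orthogonal_singleton_apply, planeForm, inner_sub_right,
    real_inner_smul_right]
  field_simp
  rw [inner_e e, inner_e x, inner_e y]
  ring

end PlaneForm

section Polygon

variable {a₁ a₂ v w p : E}

theorem eq_or_eq_of_planeForm_eq_zero (hspan : vectorSpan ℝ P ≤ Submodule.span ℝ {a₁, a₂})
    (hv : v ∈ vertices P) (hw : w ∈ vertices P) (hp : p ∈ vertices P) (hvw : v ≠ w)
    (h : planeForm a₁ a₂ (w - v) (p - v) = 0) : p = v ∨ p = w := by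
  obtain ⟨r, hr⟩ := exists_eq_smul_of_planeForm_eq_zero (hspan (sub_mem_vectorSpan hw.1 hv.1))
    (hspan (sub_mem_vectorSpan hp.1 hv.1)) (sub_ne_zero.mpr hvw.symm) h
  refine eq_or_eq_of_collinear hv hw hp hvw ?_
  rw [collinear_iff_of_mem (Set.mem_insert v _)]
  refine ⟨w - v, ?_⟩
  simp only [Set.mem_insert_iff, Set.mem_singleton_iff, forall_eq_or_imp, forall_eq, vadd_eq_add]
  exact ⟨⟨0, by module⟩, ⟨1, by module⟩, r, by rw [← hr, sub_add_cancel]⟩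

theorem IsPolytope.exists_forall_planeForm_nonneg (hP : IsPolytope P)
    (hspan : vectorSpan ℝ P ≤ Submodule.span ℝ {a₁, a₂}) (hv : v ∈ vertices P)
    (hp : p ∈ vertices P) (hpv : p ≠ v) :
    ∃ w ∈ vertices P, v ≠ w ∧ ∀ q ∈ vertices P, 0 ≤ planeForm a₁ a₂ (w - v) (q - v) := by
  obtain ⟨b, hb⟩ := hP.exists_maxFace_eq_singleton hv
  have hmem (q : E) (hq : q ∈ vertices P) : q - v ∈ Submodule.span ℝ {a₁, a₂} :=
    hspan (sub_mem_vectorSpan hq.1 hv.1)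
  have hpos (q : E) (hq : q ∈ vertices P) (hqv : q ≠ v) : 0 < ⟪b, v - q⟫ :=
    inner_sub_pos_of_maxFace_eq hb hq.1 hqv
  obtain ⟨w, ⟨hw, hwv⟩, hmin⟩ := Set.exists_min_image (vertices P \ {v})
    (fun q => planeForm a₁ a₂ (p - v) (q - v) / ⟪b, v - q⟫) hP.finite_vertices.sdiff
    ⟨p, hp, hpv⟩
  refine ⟨w, hw, Ne.symm hwv, fun q hq => ?_⟩
  obtain rfl | hqv := eq_or_ne q v
  · simp [planeForm]
  have hslope := hmin q ⟨hq, hqv⟩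
  rw [div_le_div_iff₀ (hpos w hw hwv) (hpos q hq hqv)] at hslope
  have hcyc := congrArg (fun x => ⟪b, x⟫) (planeForm_cyclic (hmem w hw) (hmem q hq) (hmem p hp))
  have inner_neg (q : E) : ⟪b, q - v⟫ = -⟪b, v - q⟫ := by rw [← inner_neg_right, neg_sub]
  simp only [inner_add_right, real_inner_smul_right, inner_zero_right, inner_neg,
    planeForm_swap a₁ a₂ (p - v) (q - v)] at hcyc
  refine nonneg_of_mul_nonneg_left ?_ (hpos p hp hpv)
  linarith

theorem IsPolytope.isEdge_of_forall_planeForm_nonneg (hP : IsPolytope P)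
    (hspan : vectorSpan ℝ P ≤ Submodule.span ℝ {a₁, a₂}) (hv : v ∈ vertices P)
    (hw : w ∈ vertices P) (hvw : v ≠ w)
    (h : ∀ p ∈ vertices P, 0 ≤ planeForm a₁ a₂ (w - v) (p - v)) : IsEdge P v w := by
  let c := ⟪a₂, w - v⟫ • a₁ - ⟪a₁, w - v⟫ • a₂
  have inner_c (p : E) : ⟪c, p⟫ = ⟪c, v⟫ - planeForm a₁ a₂ (w - v) (p - v) := by
    simp only [c, planeForm, inner_sub_left, real_inner_smul_left, inner_sub_right]
    ring
  refine ⟨hvw, hv, hw, c, hP.maxFace_eq_convexHull (Set.insert_nonempty v {w}) ?_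
    (r := ⟪c, v⟫) ?_ ?_⟩
  · simp [Set.insert_subset_iff, hv, hw]
  · rintro p (rfl | rfl)
    · rfl
    · rw [inner_c, planeForm, mul_comm, sub_self, sub_zero]
  · intro p hp hpvw
    rw [inner_c, sub_lt_self_iff]
    exact (h p hp).lt_of_ne' fun h0 =>
      hpvw (eq_or_eq_of_planeForm_eq_zero hspan hv hw hp hvw h0)

/-- Going once around the polygon, the sign would change an odd number of times. -/
theorem IsPolytope.eq_zero_of_odd (hP : IsPolytope P)
    (hspan : vectorSpan ℝ P ≤ Submodule.span ℝ {a₁, a₂}) (hne : vectorSpan ℝ P ≠ ⊥)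
    (hodd : Odd (vertices P).ncard) {D : E → ℝ} (hD : ∀ v w, IsEdge P v w → D w = -D v)
    (hv : v ∈ vertices P) : D v = 0 := by
  by_contra hDv
  have hD0 (w : E) (hw : w ∈ vertices P) : D w ≠ 0 :=
    hP.induction_on_edges (S := fun w => D w ≠ 0) hv hDv
      (fun u w huw hu => by rwa [hD u w huw, neg_ne_zero]) hw
  have hnext (u : E) (hu : u ∈ vertices P) : ∃ w ∈ vertices P, u ≠ w ∧
      ∀ q ∈ vertices P, 0 ≤ planeForm a₁ a₂ (w - u) (q - u) := by
    obtain ⟨p, hp, hpu⟩ := hP.exists_vertex_ne hne u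
    exact hP.exists_forall_planeForm_nonneg hspan hu hp hpu
  choose! next next_mem ne_next planeForm_nonneg using hnext
  have next_injOn : Set.InjOn next (vertices P) := by
    intro u hu u' hu' heq
    have h₁ := planeForm_nonneg u hu u' hu'
    have h₂ := planeForm_nonneg u' hu' u hu
    have hsum : planeForm a₁ a₂ (next u - u) (u' - u) +
        planeForm a₁ a₂ (next u' - u') (u - u') = 0 := by
      simp only [← heq, planeForm, inner_sub_right]
      ring
    exact ((eq_or_eq_of_planeForm_eq_zero hspan hu (next_mem u hu) hu' (ne_next u hu)
      (by linarith)).resolve_right (heq ▸ ne_next u' hu')).symm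
  have hneg (u : E) (hu : u ∈ vertices P) : D (next u) = -D u :=
    hD u _ (hP.isEdge_of_forall_planeForm_nonneg hspan hu (next_mem u hu) (ne_next u hu)
      (planeForm_nonneg u hu))
  lift vertices P to Finset E using hP.finite_vertices with V
  rw [Set.ncard_coe_finset, ← Nat.not_even_iff_odd] at hodd
  exact hodd (even_card_of_comp_eq_neg next_mem next_injOn hneg hD0)

end Polygon

/-- The families `y` of vectors in the direction of the affine hull of `P`, indexed by the
vertices of `P` (and extended by zero), in which the vectors at the two ends of an edge are mirror
images in the hyperplane orthogonal to the edge. An inscribed polytope that is normally equivalent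
to `P` gives such a family, the vectors from the centre of the sphere to the vertices. -/
def reflectionSpace (P : Set E) : Submodule ℝ (E → E) where
  carrier := {y | (∀ v, v ∉ vertices P → y v = 0) ∧
    (∀ v ∈ vertices P, y v ∈ vectorSpan ℝ P) ∧
    ∀ v w, IsEdge P v w → y w = (ℝ ∙ (w - v))ᗮ.reflection (y v)}
  zero_mem' := ⟨fun _ _ => rfl, fun _ _ => zero_mem _, fun _ _ _ => (map_zero _).symm⟩
  add_mem' := by
    rintro x y ⟨hx₁, hx₂, hx₃⟩ ⟨hy₁, hy₂, hy₃⟩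
    refine ⟨fun v hv => ?_, fun v hv => add_mem (hx₂ v hv) (hy₂ v hv), fun v w h => ?_⟩
    · rw [Pi.add_apply, hx₁ v hv, hy₁ v hv, add_zero]
    · rw [Pi.add_apply, Pi.add_apply, map_add, hx₃ v w h, hy₃ v w h]
  smul_mem' := by
    rintro a x ⟨hx₁, hx₂, hx₃⟩
    refine ⟨fun v hv => ?_, fun v hv => Submodule.smul_mem _ a (hx₂ v hv), fun v w h => ?_⟩
    · rw [Pi.smul_apply, hx₁ v hv, smul_zero]
    · rw [Pi.smul_apply, Pi.smul_apply, map_smul, hx₃ v w h]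

theorem IsPolytope.eq_zero_of_mem_reflectionSpace (hP : IsPolytope P) {y : E → E}
    (hy : y ∈ reflectionSpace P) {v₀ : E} (hv₀ : v₀ ∈ vertices P) (h₀ : y v₀ = 0) : y = 0 := by
  obtain ⟨hout, -, hedge⟩ := hy
  ext v
  by_cases hv : v ∈ vertices P
  · refine hP.induction_on_edges (S := fun v => y v = 0) hv₀ h₀ (fun v w hvw h => ?_) hv
    rw [hedge v w hvw, h, map_zero]
  · exact hout v hv

theorem IsInscribed.exists_center (hI : IsInscribed Q) (hQ : IsPolytope Q) :
    ∃ z r, (∀ u ∈ vertices Q, u - z ∈ vectorSpan ℝ Q) ∧ ∀ u ∈ vertices Q, ‖u - z‖ = r := by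
  obtain ⟨z₀, r₀, hr₀⟩ := hI
  have := hQ.nonempty.to_subtype
  have : FiniteDimensional ℝ (affineSpan ℝ Q).direction := by
    rw [direction_affineSpan]
    exact hQ.finiteDimensional_vectorSpan
  have vertices_subset : vertices Q ⊆ affineSpan ℝ Q := fun u hu => subset_affineSpan ℝ Q hu.1
  obtain ⟨r, hr⟩ := (EuclideanGeometry.exists_dist_eq_iff_exists_dist_orthogonalProjection_eq
    vertices_subset z₀).1 ⟨r₀, fun u hu => hr₀ hu⟩
  refine ⟨EuclideanGeometry.orthogonalProjection (affineSpan ℝ Q) z₀, r, fun u hu => ?_,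
    fun u hu => by rw [← dist_eq_norm, hr u hu]⟩
  rw [← direction_affineSpan]
  exact AffineSubspace.vsub_mem_direction (vertices_subset hu)
    (EuclideanGeometry.orthogonalProjection_mem z₀)

theorem NormallyEquivalent.exists_mem_reflectionSpace (h : NormallyEquivalent Q P)
    (hP : IsPolytope P) (hQ : IsPolytope Q) (hI : IsInscribed Q) :
    ∃ y ∈ reflectionSpace P, ∃ z, ∀ v ∈ vertices P, vertexMap P Q v = z + y v := by
  obtain ⟨z, r, hspan, hr⟩ := hI.exists_center hQ
  rw [← maxFace_zero (P := Q), h.vectorSpan_eq 0, maxFace_zero, maxFace_zero] at hspan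
  have vertexMap_mem : ∀ v ∈ vertices P, vertexMap P Q v ∈ vertices Q := fun v hv => by
    rw [h.vertices_eq hP hQ]
    exact ⟨v, hv, rfl⟩
  refine ⟨(vertices P).indicator fun v => vertexMap P Q v - z,
    ⟨fun v hv => Set.indicator_of_notMem hv _, fun v hv => ?_, fun v w hvw => ?_⟩,
    z, fun v hv => ?_⟩
  · rw [Set.indicator_of_mem hv]
    exact hspan _ (vertexMap_mem v hv)
  · obtain ⟨μ, hμ, hsub⟩ := h.exists_vertexMap_sub hP hQ hvw
    obtain ⟨-, hv, hw, -⟩ := hvw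
    have edge_eq : (ℝ ∙ (w - v)) =
        ℝ ∙ ((vertexMap P Q v - z) - (vertexMap P Q w - z)) := by
      rw [sub_sub_sub_cancel_right, ← neg_sub (vertexMap P Q w), hsub, ← neg_smul,
        Submodule.span_singleton_smul_eq (neg_ne_zero.2 hμ.ne').isUnit]
    rw [Set.indicator_of_mem hv, Set.indicator_of_mem hw]
    simp only [edge_eq]
    refine (Submodule.reflection_sub ?_).symm
    rw [hr _ (vertexMap_mem v hv), hr _ (vertexMap_mem w hw)]
  · rw [Set.indicator_of_mem hv, add_sub_cancel]

theorem supportFun_eq {c x : E} (hx : x ∈ maxFace P c) : supportFun P c = ⟪c, x⟫ :=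
  IsGreatest.csSup_eq ⟨⟨x, hx.1, rfl⟩, Set.forall_mem_image.2 hx.2⟩

open Classical in
/-- A choice of a vertex of `P` at which `⟪c, ·⟫` is maximal. -/
def topVertex (P : Set E) (c : E) : E :=
  if h : (vertices (maxFace P c)).Nonempty then h.choose else 0

theorem IsPolytope.topVertex_mem (hP : IsPolytope P) (c : E) :
    topVertex P c ∈ maxFace P c ∩ vertices P := by
  have h := (hP.isPolytope_maxFace c).vertices_nonempty
  rw [topVertex, dif_pos h, ← vertices_maxFace]
  exact h.choose_spec

theorem NormallyEquivalent.supportFun_eq (h : NormallyEquivalent Q P) (hP : IsPolytope P)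
    (hQ : IsPolytope Q) (c : E) : supportFun Q c = ⟪c, vertexMap P Q (topVertex P c)⟫ :=
  have ⟨hface, hvertex⟩ := hP.topVertex_mem c
  InscribedCone.supportFun_eq (h.vertexMap_mem_maxFace hP hQ hvertex hface)

/-- The class modulo linear functions of `c ↦ ⟪c, y (topVertex P c)⟫`, which is the support
function of `Q` when `y v` is the vertex of `Q` that corresponds to the vertex `v` of `P`. -/
def familyClass (P : Set E) : (E → E) →ₗ[ℝ] (E → ℝ) ⧸ linearFuns E :=
  (linearFuns E).mkQ ∘ₗ
    { toFun := fun y c => ⟪c, y (topVertex P c)⟫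
      map_add' := fun _ _ => funext fun _ => inner_add_right _ _ _
      map_smul' := fun _ _ => funext fun _ => real_inner_smul_right _ _ _ }

theorem NormallyEquivalent.translationClass_eq (h : NormallyEquivalent Q P) (hP : IsPolytope P)
    (hQ : IsPolytope Q) {y : E → E} {z : E} (hy : ∀ v ∈ vertices P, vertexMap P Q v = z + y v) :
    translationClass Q = familyClass P y := by
  refine (Submodule.Quotient.eq _).2 ⟨z, funext fun c => ?_⟩
  simp [h.supportFun_eq hP hQ, hy _ (hP.topVertex_mem c).2, inner_add_right]

theorem IsPolytope.inCone_subset (hP : IsPolytope P) :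
    inCone P ⊆ (reflectionSpace P).map (familyClass P) := by
  rintro _ ⟨Q, hQ, hI, h, rfl⟩
  obtain ⟨y, hy, z, hz⟩ := h.exists_mem_reflectionSpace hP hQ hI
  exact ⟨y, hy, (h.translationClass_eq hP hQ hz).symm⟩

theorem IsOddTwoFace.planeForm_eq_zero_of_le_span {F : Set E} (hF : IsOddTwoFace P F)
    (hP : IsPolytope P) {a₁ a₂ : E} (hspan : vectorSpan ℝ F ≤ Submodule.span ℝ {a₁, a₂})
    {x y : E → E} (hx : x ∈ reflectionSpace P) (hy : y ∈ reflectionSpace P) {v : E}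
    (hv : v ∈ vertices F) : planeForm a₁ a₂ (x v) (y v) = 0 := by
  obtain ⟨⟨⟨c, rfl⟩, hdim⟩, hodd⟩ := hF
  refine (hP.isPolytope_maxFace c).eq_zero_of_odd (D := fun v => planeForm a₁ a₂ (x v) (y v))
    hspan ?_ hodd (fun v w hvw => ?_) hv
  · intro h
    rw [polyDim_eq, h, finrank_bot] at hdim
    norm_num at hdim
  · have hvw' := hP.isEdge_of_isEdge_maxFace hvw
    rw [hx.2.2 v w hvw', hy.2.2 v w hvw']
    exact planeForm_reflection (hspan (sub_mem_vectorSpan hvw.2.2.1.1 hvw.2.1.1))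
      (sub_ne_zero.mpr hvw.1.symm)

theorem exists_le_span_pair {L : Submodule ℝ E} (hL : finrank ℝ L = 2) :
    ∃ a₁ a₂ : E, L ≤ Submodule.span ℝ {a₁, a₂} := by
  have : FiniteDimensional ℝ L := FiniteDimensional.of_finrank_pos (by omega)
  let b := finBasisOfFinrankEq ℝ L hL
  refine ⟨b 0, b 1, fun x hx => Submodule.mem_span_pair.2
    ⟨b.repr ⟨x, hx⟩ 0, b.repr ⟨x, hx⟩ 1, ?_⟩⟩
  have hsum := congrArg Subtype.val (b.sum_repr ⟨x, hx⟩)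
  rwa [Fin.sum_univ_two] at hsum

theorem IsOddTwoFace.planeForm_eq_zero {F : Set E} (hF : IsOddTwoFace P F) (hP : IsPolytope P)
    {x y : E → E} (hx : x ∈ reflectionSpace P) (hy : y ∈ reflectionSpace P) {v : E}
    (hv : v ∈ vertices F) {e f : E} (he : e ∈ vectorSpan ℝ F) (hf : f ∈ vectorSpan ℝ F) :
    planeForm e f (x v) (y v) = 0 := by
  obtain ⟨a₁, a₂, hspan⟩ := exists_le_span_pair ((polyDim_eq F).symm.trans hF.1.2)
  have h := hF.planeForm_eq_zero_of_le_span hP hspan hx hy hv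
  obtain ⟨s, t, rfl⟩ := Submodule.mem_span_pair.1 (hspan he)
  obtain ⟨s', t', rfl⟩ := Submodule.mem_span_pair.1 (hspan hf)
  simp only [planeForm, inner_add_left, real_inner_smul_left] at h ⊢
  linear_combination (s * t' - s' * t) * h

theorem IsOddTwoFace.mem_orthogonal {F : Set E} (hF : IsOddTwoFace P F) (hP : IsPolytope P)
    {x y : E → E} (hx : x ∈ reflectionSpace P) (hy : y ∈ reflectionSpace P) {v : E}
    (hv : v ∈ vertices F) {e : E} (he : e ∈ vectorSpan ℝ F) (hxe : ⟪e, x v⟫ ≠ 0)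
    (hye : ⟪e, y v⟫ = 0) : y v ∈ (vectorSpan ℝ F)ᗮ := by
  intro f hf
  have h := hF.planeForm_eq_zero hP hx hy hv he hf
  rw [planeForm, hye, mul_zero, sub_zero] at h
  exact (mul_eq_zero.mp h).resolve_left hxe

/-- The vectors at the vertex `v` of the families in `reflectionSpace P`. -/
def reflectionSpaceAt (P : Set E) (v : E) : Submodule ℝ E :=
  (reflectionSpace P).map (LinearMap.proj v)

theorem reflectionSpaceAt_le {v : E} (hv : v ∈ vertices P) :
    reflectionSpaceAt P v ≤ vectorSpan ℝ P := by
  rintro _ ⟨y, hy, rfl⟩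
  exact hy.2.1 v hv

theorem IsPolytope.inConeDim_le_finrank (hP : IsPolytope P) {v : E} (hv : v ∈ vertices P) :
    inConeDim P ≤ finrank ℝ (reflectionSpaceAt P v) := by
  have := hP.finiteDimensional_vectorSpan
  have : FiniteDimensional ℝ (reflectionSpaceAt P v) :=
    Submodule.finiteDimensional_of_le (reflectionSpaceAt_le hv)
  let eval : reflectionSpace P →ₗ[ℝ] reflectionSpaceAt P v :=
    (LinearMap.proj v).submoduleMap (reflectionSpace P)
  have eval_injective : Function.Injective eval :=
    (injective_iff_map_eq_zero _).mpr fun y hy =>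
      Subtype.ext (hP.eq_zero_of_mem_reflectionSpace y.2 hv (congrArg Subtype.val hy))
  calc inConeDim P
      ≤ Module.rank ℝ ((reflectionSpace P).map (familyClass P)) :=
        Submodule.rank_mono (Submodule.span_le.mpr hP.inCone_subset)
    _ ≤ Module.rank ℝ (reflectionSpace P) := rank_map_le _ _
    _ ≤ Module.rank ℝ (reflectionSpaceAt P v) := LinearMap.rank_le_of_injective _ eval_injective
    _ = finrank ℝ (reflectionSpaceAt P v) := (finrank_eq_rank _ _).symm

theorem finrank_add_finrank_le {M K W : Submodule ℝ E} [FiniteDimensional ℝ M] (hK : K ≤ M)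
    (hW : W ≤ M) {e : E} (h : ∀ y ∈ W, ⟪e, y⟫ = 0 → y ∈ Kᗮ) :
    finrank ℝ W + finrank ℝ K ≤ finrank ℝ M + 1 := by
  have : FiniteDimensional ℝ W := Submodule.finiteDimensional_of_le hW
  let φ : W →ₗ[ℝ] ℝ := (innerₛₗ ℝ e) ∘ₗ W.subtype
  have ker_le : (LinearMap.ker φ).map W.subtype ≤ Kᗮ ⊓ M := by
    rintro _ ⟨y, hy, rfl⟩
    exact ⟨h y y.2 hy, hW y.2⟩
  have finrank_ker : finrank ℝ (LinearMap.ker φ) ≤ finrank ℝ (Kᗮ ⊓ M : Submodule ℝ E) := by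
    rw [← Submodule.finrank_map_subtype_eq]
    exact Submodule.finrank_mono ker_le
  have finrank_range : finrank ℝ (LinearMap.range φ) ≤ 1 :=
    (Submodule.finrank_le _).trans_eq (finrank_self ℝ)
  have := φ.finrank_range_add_finrank_ker
  have := Submodule.finrank_add_inf_finrank_orthogonal hK
  omega

theorem IsPolytope.inConeDim_le_of_mem_orthogonal (hP : IsPolytope P) {v : E}
    (hv : v ∈ vertices P) {K : Submodule ℝ E} (hK : K ≤ vectorSpan ℝ P) {e : E}
    (h : ∀ y ∈ reflectionSpace P, ⟪e, y v⟫ = 0 → y v ∈ Kᗮ) :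
    inConeDim P ≤ (polyDim P + 1 - finrank ℝ K : ℕ) := by
  have := hP.finiteDimensional_vectorSpan
  refine (hP.inConeDim_le_finrank hv).trans (Nat.cast_le.2 ?_)
  have := finrank_add_finrank_le hK (reflectionSpaceAt_le hv) (e := e) <| by
    rintro _ ⟨y, hy, rfl⟩
    exact h y hy
  rw [polyDim_eq]
  omega

theorem IsFace.isPolytope {F : Set E} (hF : IsFace P F) (hP : IsPolytope P) : IsPolytope F := by
  obtain ⟨c, rfl⟩ := hF
  exact hP.isPolytope_maxFace c

theorem IsFace.vertices_eq {F : Set E} (hF : IsFace P F) : vertices F = F ∩ vertices P := by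
  obtain ⟨c, rfl⟩ := hF
  exact vertices_maxFace P c

theorem IsFace.subset {F : Set E} (hF : IsFace P F) : F ⊆ P := by
  obtain ⟨c, rfl⟩ := hF
  exact maxFace_subset P c

theorem IsFace.mem_of_sub_mem_vectorSpan {F : Set E} (hF : IsFace P F) {v p : E} (hv : v ∈ F)
    (hp : p ∈ P) (h : p - v ∈ vectorSpan ℝ F) : p ∈ F := by
  obtain ⟨c, rfl⟩ := hF
  have hpv := inner_eq_zero_of_mem_vectorSpan_maxFace h
  rw [inner_sub_right, sub_eq_zero] at hpv
  exact mem_maxFace_of_inner_le hv hp hpv.ge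

theorem IsFace.subset_of_vectorSpan_le {F G : Set E} (hF : IsFace P F) (hG : IsFace P G) {v : E}
    (hvF : v ∈ F) (hvG : v ∈ G) (h : vectorSpan ℝ F ≤ vectorSpan ℝ G) : F ⊆ G := fun _ hp =>
  hG.mem_of_sub_mem_vectorSpan hvG (hF.subset hp) (h (sub_mem_vectorSpan hp hvF))

theorem IsPolytope.inConeDim_le_of_isOddTwoFace (hP : IsPolytope P) {F : Set E}
    (hF : IsOddTwoFace P F) : inConeDim P ≤ (polyDim P - 1 : ℕ) := by
  obtain ⟨hface, hdim⟩ := hF.1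
  obtain ⟨v, hv⟩ := (hface.isPolytope hP).vertices_nonempty
  have hvP : v ∈ vertices P := (hface.vertices_eq ▸ hv).2
  suffices ∃ e, ∀ y ∈ reflectionSpace P, ⟪e, y v⟫ = 0 → y v ∈ (vectorSpan ℝ F)ᗮ by
    obtain ⟨e, he⟩ := this
    have hle := hP.inConeDim_le_of_mem_orthogonal hvP (vectorSpan_mono ℝ hface.subset) he
    rwa [← polyDim_eq, hdim] at hle
  by_cases hx : ∃ x ∈ reflectionSpace P, ∃ e ∈ vectorSpan ℝ F, ⟪e, x v⟫ ≠ 0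
  · obtain ⟨x, hx, e, he, hxe⟩ := hx
    exact ⟨e, fun y hy hye => hF.mem_orthogonal hP hx hy hv he hxe hye⟩
  · push Not at hx
    exact ⟨0, fun y hy _ e he => hx y hy e he⟩

theorem NormallyInscribable.exists_inner_ne_zero (hI : NormallyInscribable P) (hP : IsPolytope P)
    {v w : E} (hvw : IsEdge P v w) : ∃ x ∈ reflectionSpace P, ⟪w - v, x v⟫ ≠ 0 := by
  obtain ⟨_, Q, hQ, hIQ, h, -⟩ := hI
  obtain ⟨x, hx, z, hz⟩ := h.exists_mem_reflectionSpace hP hQ hIQ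
  refine ⟨x, hx, fun horth => ?_⟩
  obtain ⟨μ, hμ, hsub⟩ := h.exists_vertexMap_sub hP hQ hvw
  rw [hz w hvw.2.2.1, hz v hvw.2.1, hx.2.2 v w hvw, Submodule.reflection_mem_subspace_eq_self
    (Submodule.mem_orthogonal_singleton_iff_inner_right.2 horth), sub_self, eq_comm] at hsub
  exact (smul_ne_zero hμ.ne' (sub_ne_zero.2 hvw.1.symm)) hsub

theorem IsPolytope.exists_isEdge_of_polyDim_pos (hP : IsPolytope P) (h : 0 < polyDim P) :
    ∃ v w, IsEdge P v w := by
  obtain ⟨v, hv⟩ := hP.vertices_nonempty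
  have vectorSpan_ne_bot : vectorSpan ℝ P ≠ ⊥ := fun hbot => by
    rw [polyDim_eq, hbot, finrank_bot] at h
    exact h.false
  obtain ⟨p, hp, hpv⟩ := hP.exists_vertex_ne vectorSpan_ne_bot v
  exact ⟨v, hP.exists_isEdge hv hp.1 hpv⟩

theorem IsFace.polyDim_lt_finrank_sup {F₁ F₂ : Set E} (hF₁ : IsFace P F₁) (hF₂ : IsFace P F₂)
    (hP : IsPolytope P) (hne : (F₁ ∩ F₂).Nonempty) (hsub : ¬F₁ ⊆ F₂) :
    polyDim F₂ < finrank ℝ (vectorSpan ℝ F₁ ⊔ vectorSpan ℝ F₂ : Submodule ℝ E) := by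
  have := (hF₁.isPolytope hP).finiteDimensional_vectorSpan
  have := (hF₂.isPolytope hP).finiteDimensional_vectorSpan
  obtain ⟨v, hv₁, hv₂⟩ := hne
  rw [polyDim_eq]
  refine Submodule.finrank_lt_finrank_of_lt (lt_of_le_of_ne le_sup_right fun heq => hsub ?_)
  exact hF₁.subset_of_vectorSpan_le hF₂ hv₁ hv₂ (sup_eq_right.1 heq.symm)

theorem IsPolytope.inConeDim_le_of_adjacent (hP : IsPolytope P) {F₁ F₂ : Set E}
    (hF₁ : IsOddTwoFace P F₁) (hF₂ : IsOddTwoFace P F₂) (hF : IsFaceOfDim P 1 (F₁ ∩ F₂)) :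
    inConeDim P ≤ (polyDim P - 2 : ℕ) := by
  rcases (inCone P).eq_empty_or_nonempty with hempty | hI
  · rw [inConeDim, hempty, Submodule.span_empty, rank_bot]
    exact zero_le
  obtain ⟨hface, hdim⟩ := hF
  obtain ⟨v, w, hvw⟩ := (hface.isPolytope hP).exists_isEdge_of_polyDim_pos (by omega)
  obtain ⟨c, hc⟩ := hface
  have hvwP : IsEdge P v w := hP.isEdge_of_isEdge_maxFace (hc ▸ hvw)
  have hv : v ∈ F₁ ∩ F₂ := hvw.2.1.1
  have hw : w ∈ F₁ ∩ F₂ := hvw.2.2.1.1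
  obtain ⟨x, hx, hxe⟩ := NormallyInscribable.exists_inner_ne_zero hI hP hvwP
  have hsup : vectorSpan ℝ F₁ ⊔ vectorSpan ℝ F₂ ≤ vectorSpan ℝ P :=
    sup_le (vectorSpan_mono ℝ hF₁.1.1.subset) (vectorSpan_mono ℝ hF₂.1.1.subset)
  refine (hP.inConeDim_le_of_mem_orthogonal hvwP.2.1 hsup (e := w - v) fun y hy hye => ?_).trans
    (Nat.cast_le.2 ?_)
  · rw [← Submodule.inf_orthogonal]
    exact ⟨hF₁.mem_orthogonal hP hx hy (hF₁.1.1.vertices_eq ▸ ⟨hv.1, hvwP.2.1⟩)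
        (sub_mem_vectorSpan hw.1 hv.1) hxe hye,
      hF₂.mem_orthogonal hP hx hy (hF₂.1.1.vertices_eq ▸ ⟨hv.2, hvwP.2.1⟩)
        (sub_mem_vectorSpan hw.2 hv.2) hxe hye⟩
  · have hsub : ¬F₁ ⊆ F₂ := fun hsub => by
      rw [Set.inter_eq_left.2 hsub, hF₁.1.2] at hdim
      omega
    have := hF₁.1.1.polyDim_lt_finrank_sup hF₂.1.1 hP ⟨v, hv⟩ hsub
    rw [hF₂.1.2] at this
    omega

theorem IsPolytope.inner_le_supportFun (hP : IsPolytope P) {x : E} (hx : x ∈ P) (c : E) :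
    ⟪c, x⟫ ≤ supportFun P c := by
  obtain ⟨y, hy⟩ := hP.maxFace_nonempty c
  exact (hy.2 x hx).trans_eq (supportFun_eq hy).symm

theorem IsPolytope.mem_iff_forall_inner_le (hP : IsPolytope P) {x : E} :
    x ∈ P ↔ ∀ c, ⟪c, x⟫ ≤ supportFun P c := by
  refine ⟨fun hx => hP.inner_le_supportFun hx, fun hx => ?_⟩
  by_contra hxP
  rw [← hP.convexHull_vertices] at hxP
  obtain ⟨c, hc⟩ := exists_inner_lt_of_notMem_convexHull hP.finite_vertices hxP
  have ⟨hface, hvertex⟩ := hP.topVertex_mem c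
  exact (hx c).not_gt ((supportFun_eq hface).trans_lt (hc _ hvertex))

theorem NormallyEquivalent.supportFun_add_supportFun_neg_pos (h : NormallyEquivalent Q P)
    (hP : IsPolytope P) (hQ : IsPolytope Q) {v w : E} (hvw : IsEdge P v w) :
    0 < supportFun Q (w - v) + supportFun Q (-(w - v)) := by
  obtain ⟨μ, hμ, hsub⟩ := h.exists_vertexMap_sub hP hQ hvw
  have vertexMap_mem : ∀ u ∈ vertices P, vertexMap P Q u ∈ Q := fun u hu =>
    (h.vertices_eq hP hQ ▸ Set.mem_image_of_mem _ hu : vertexMap P Q u ∈ vertices Q).1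
  calc 0 < μ * ⟪w - v, w - v⟫ :=
        mul_pos hμ (real_inner_self_pos.mpr (sub_ne_zero.mpr hvw.1.symm))
    _ = ⟪w - v, vertexMap P Q w⟫ + ⟪-(w - v), vertexMap P Q v⟫ := by
        rw [inner_neg_left, ← sub_eq_add_neg, ← inner_sub_right, hsub, real_inner_smul_right]
    _ ≤ supportFun Q (w - v) + supportFun Q (-(w - v)) :=
        add_le_add (hQ.inner_le_supportFun (vertexMap_mem w hvw.2.2.1) _)
          (hQ.inner_le_supportFun (vertexMap_mem v hvw.2.1) _)

theorem NormallyEquivalent.translationClass_ne_zero (h : NormallyEquivalent Q P)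
    (hP : IsPolytope P) (hQ : IsPolytope Q) (hdim : 0 < polyDim P) :
    translationClass Q ≠ 0 := by
  intro h0
  obtain ⟨t, ht⟩ := (Submodule.Quotient.mk_eq_zero _).1 h0
  have supportFun_eq : ∀ c, supportFun Q c = ⟪c, t⟫ := congrFun ht
  obtain ⟨v, w, hvw⟩ := hP.exists_isEdge_of_polyDim_pos hdim
  have hpos := h.supportFun_add_supportFun_neg_pos hP hQ hvw
  rw [supportFun_eq, supportFun_eq, inner_neg_left, add_neg_cancel] at hpos
  exact hpos.false

theorem IsPolytope.one_le_inConeDim (hP : IsPolytope P) (hdim : 0 < polyDim P)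
    (hI : NormallyInscribable P) : 1 ≤ inConeDim P := by
  obtain ⟨_, Q, hQ, hIQ, h, rfl⟩ := hI
  rw [Cardinal.one_le_iff_ne_zero, inConeDim, Ne, Submodule.rank_eq_zero]
  intro hbot
  refine h.translationClass_ne_zero hP hQ hdim ?_
  rw [← Submodule.mem_bot ℝ, ← hbot]
  exact Submodule.subset_span ⟨Q, hQ, hIQ, h, rfl⟩

theorem IsPolytope.eq_image_of_supportFun_eq (hP : IsPolytope P) (hQ : IsPolytope Q) {a : ℝ}
    (ha : 0 < a) {t : E} (h : ∀ c, supportFun Q c = a * supportFun P c + ⟪c, t⟫) :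
    Q = (fun x => a • x + t) '' P := by
  have mem_iff : ∀ x, a • x + t ∈ Q ↔ x ∈ P := fun x => by
    rw [hQ.mem_iff_forall_inner_le, hP.mem_iff_forall_inner_le]
    refine forall_congr' fun c => ?_
    rw [h, inner_add_right, real_inner_smul_right, add_le_add_iff_right, mul_le_mul_iff_right₀ ha]
  ext y
  constructor
  · intro hy
    have eq_y : a • a⁻¹ • (y - t) + t = y := by rw [smul_inv_smul₀ ha.ne', sub_add_cancel]
    exact ⟨a⁻¹ • (y - t), (mem_iff _).1 (eq_y.symm ▸ hy), eq_y⟩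
  · rintro ⟨x, hx, rfl⟩
    exact (mem_iff x).2 hx

theorem IsPolytope.exists_homothety (hP : IsPolytope P) (hdim : 0 < polyDim P)
    (hcone : inConeDim P ≤ 1) {Q Q' : Set E} (hQ : IsPolytope Q) (hI : IsInscribed Q)
    (h : NormallyEquivalent Q P) (hQ' : IsPolytope Q') (hI' : IsInscribed Q')
    (h' : NormallyEquivalent Q' P) :
    ∃ (a : ℝ) (t : E), 0 < a ∧ Q' = (fun x => a • x + t) '' Q := by
  obtain ⟨q, hq⟩ := (rank_submodule_le_one_iff' _).1 hcone
  obtain ⟨r, hr⟩ := Submodule.mem_span_singleton.1 (hq (Submodule.subset_span ⟨Q, hQ, hI, h, rfl⟩))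
  obtain ⟨r', hr'⟩ :=
    Submodule.mem_span_singleton.1 (hq (Submodule.subset_span ⟨Q', hQ', hI', h', rfl⟩))
  have hr0 : r ≠ 0 := by
    rintro rfl
    exact h.translationClass_ne_zero hP hQ hdim (hr.symm.trans (zero_smul ℝ q))
  set a := r' / r
  have class_eq : translationClass Q' = a • translationClass Q := by
    rw [← hr, ← hr', smul_smul, div_mul_cancel₀ r' hr0]
  obtain ⟨t, ht⟩ := (Submodule.Quotient.eq (linearFuns E)).1 class_eq
  have supportFun_eq : ∀ c, supportFun Q' c = a * supportFun Q c + ⟪c, t⟫ := fun c =>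
    sub_eq_iff_eq_add'.1 (congrFun ht c)
  have ha : 0 < a := by
    obtain ⟨v, w, hvw⟩ := hP.exists_isEdge_of_polyDim_pos hdim
    have width_pos := h.supportFun_add_supportFun_neg_pos hP hQ hvw
    have width_pos' := h'.supportFun_add_supportFun_neg_pos hP hQ' hvw
    rw [supportFun_eq, supportFun_eq, inner_neg_left] at width_pos'
    exact pos_of_mul_pos_left (by linarith) width_pos.le
  exact ⟨a, t, ha, hQ.eq_image_of_supportFun_eq hQ' ha supportFun_eq⟩

theorem normalCone_subset_of_normalFan_eq (h : normalFan Q = normalFan P) (c : E) :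
    normalCone Q (maxFace Q c) ⊆ normalCone P (maxFace P c) := by
  obtain ⟨G, -, hG⟩ : normalCone P (maxFace P c) ∈ normalFan Q := h ▸ ⟨_, ⟨c, rfl⟩, rfl⟩
  have hc : G ⊆ maxFace Q c := (hG ▸ subset_refl (maxFace P c) : c ∈ normalCone Q G)
  rw [hG]
  exact fun d hd => hc.trans hd

theorem IsPolytope.mem_vectorSpan_maxFace_iff (hP : IsPolytope P) {c x : E} :
    x ∈ vectorSpan ℝ (maxFace P c) ↔ ∀ d ∈ normalCone P (maxFace P c), ⟪d, x⟫ = 0 := by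
  refine ⟨fun hx d hd => inner_eq_zero_of_mem_vectorSpan
    (fun p hp q hq => inner_eq_of_mem_maxFace (hd hp) (hd hq)) hx, fun h => ?_⟩
  have := (hP.isPolytope_maxFace c).finiteDimensional_vectorSpan
  rw [← Submodule.orthogonal_orthogonal (vectorSpan ℝ (maxFace P c))]
  intro d hd
  obtain ⟨ε, hface, hε⟩ := ((hP.eventually_maxFace_add c d).and self_mem_nhdsWithin).exists
  have hcone : maxFace P c ⊆ maxFace (maxFace P c) d := fun p hp => by
    refine ⟨hp, fun q hq => ?_⟩
    have hpq := hd _ (sub_mem_vectorSpan hp hq)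
    rw [real_inner_comm, inner_sub_right, sub_eq_zero] at hpq
    exact hpq.ge
  have hx := h (c + ε • d) (hcone.trans hface.ge)
  rw [inner_add_left, h c (subset_refl (maxFace P c)), zero_add, real_inner_smul_left] at hx
  exact (mul_eq_zero.mp hx).resolve_left (ne_of_gt hε)

theorem IsPolytope.normallyEquivalent_of_normalFan_eq (hP : IsPolytope P) (hQ : IsPolytope Q)
    (h : normalFan Q = normalFan P) : NormallyEquivalent Q P := by
  intro c
  rw [AffineSubspace.parallel_iff_direction_eq_and_eq_bot_iff_eq_bot, direction_affineSpan,
    direction_affineSpan, affineSpan_eq_bot, affineSpan_eq_bot]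
  refine ⟨?_, iff_of_false (hQ.maxFace_nonempty c).ne_empty (hP.maxFace_nonempty c).ne_empty⟩
  ext x
  rw [hP.mem_vectorSpan_maxFace_iff, hQ.mem_vectorSpan_maxFace_iff,
    (normalCone_subset_of_normalFan_eq h c).antisymm (normalCone_subset_of_normalFan_eq h.symm c)]

theorem exists_mem_orthogonal_inner_pos {K : Submodule ℝ E} [K.HasOrthogonalProjection] {x : E}
    (hx : x ∉ K) : ∃ d ∈ Kᗮ, 0 < ⟪d, x⟫ := by
  refine ⟨x - K.starProjection x, K.sub_starProjection_mem_orthogonal x, ?_⟩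
  have hinner : ⟪x - K.starProjection x, x⟫ = ⟪x - K.starProjection x, x - K.starProjection x⟫ := by
    rw [inner_sub_right _ x, real_inner_comm (K.starProjection x),
      K.sub_starProjection_mem_orthogonal x _ (K.starProjection_apply_mem x), sub_zero]
  rw [hinner, real_inner_self_pos, sub_ne_zero]
  exact fun h => hx (h ▸ K.starProjection_apply_mem x)

/-- Tilting a supporting hyperplane about `g` until it hits a further point of `P`. -/
theorem IsPolytope.exists_mem_maxFace_add_smul (hP : IsPolytope P) {c d g p₀ : E}
    (hg : g ∈ maxFace P c) (hp₀ : p₀ ∈ P) (hd : ⟪d, g⟫ < ⟪d, p₀⟫) :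
    ∃ t : ℝ, g ∈ maxFace P (c + t • d) ∧ ∃ p ∈ maxFace P (c + t • d), ⟪d, g⟫ < ⟪d, p⟫ := by
  have hgd : g ∉ maxFace P d := fun h => (h.2 p₀ hp₀).not_gt hd
  obtain ⟨q₀, hq₀, hq₀d⟩ := hP.exists_vertex_inner_lt hg.1 hgd
  obtain ⟨p, ⟨hp, hpd⟩, hmin⟩ := Set.exists_min_image
    {p | p ∈ vertices P ∧ ⟪d, g⟫ < ⟪d, p⟫}
    (fun p => (⟪c, g⟫ - ⟪c, p⟫) / (⟪d, p⟫ - ⟪d, g⟫))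
    (hP.finite_vertices.subset fun _ h => h.1) ⟨q₀, hq₀, hq₀d⟩
  set t := (⟪c, g⟫ - ⟪c, p⟫) / (⟪d, p⟫ - ⟪d, g⟫)
  have ht₀ : 0 ≤ t := div_nonneg (sub_nonneg.mpr (hg.2 p hp.1)) (sub_pos.mpr hpd).le
  have inner_tilt (q : E) : ⟪c + t • d, q⟫ = ⟪c, q⟫ + t * ⟪d, q⟫ := by
    rw [inner_add_left, real_inner_smul_left]
  have hgt : g ∈ maxFace P (c + t • d) := by
    by_contra hgt
    obtain ⟨q, hq, hlt⟩ := hP.exists_vertex_inner_lt hg.1 hgt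
    rw [inner_tilt, inner_tilt] at hlt
    by_cases hqd : ⟪d, g⟫ < ⟪d, q⟫
    · have hle := hmin q ⟨hq, hqd⟩
      rw [le_div_iff₀ (sub_pos.mpr hqd)] at hle
      linarith
    · linarith [hg.2 q hq.1, mul_le_mul_of_nonneg_left (not_lt.mp hqd) ht₀]
  refine ⟨t, hgt, p, mem_maxFace_of_inner_le hgt hp.1 ?_, hpd⟩
  have hmul : t * (⟪d, p⟫ - ⟪d, g⟫) = ⟪c, g⟫ - ⟪c, p⟫ := div_mul_cancel₀ _ (sub_pos.mpr hpd).ne'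
  rw [inner_tilt, inner_tilt]
  linarith

theorem isFace_self (P : Set E) : IsFace P P :=
  ⟨0, (maxFace_zero P).symm⟩

theorem IsFace.polyDim_lt_of_ssubset {F G : Set E} (hF : IsFace P F) (hG : IsFace P G)
    (hP : IsPolytope P) (hFG : F ⊂ G) : polyDim F < polyDim G := by
  have := (hG.isPolytope hP).finiteDimensional_vectorSpan
  obtain ⟨v, hv⟩ := (hF.isPolytope hP).nonempty
  rw [polyDim_eq, polyDim_eq]
  refine Submodule.finrank_lt_finrank_of_lt (lt_of_le_of_ne (vectorSpan_mono ℝ hFG.1) fun heq => ?_)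
  exact hFG.2 (hG.subset_of_vectorSpan_le hF (hFG.1 hv) hv heq.ge)

theorem IsPolytope.exists_vertex_sub_notMem (hP : IsPolytope P) {K : Submodule ℝ E}
    [FiniteDimensional ℝ K] {v : E} (hv : v ∈ vertices P) (hK : finrank ℝ K < polyDim P) :
    ∃ p ∈ vertices P, p - v ∉ K := by
  by_contra! h
  rw [polyDim_eq] at hK
  exact (Submodule.finrank_mono (hP.vectorSpan_le hv h)).not_gt hK

theorem IsFace.exists_isFace_ssuperset {F : Set E} (hF : IsFace P F) (hP : IsPolytope P)
    (hne : F ≠ P) (hdim : polyDim F + 1 < polyDim P) : ∃ G, IsFace P G ∧ G ≠ P ∧ F ⊂ G := by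
  obtain ⟨p₁, hp₁, hp₁F⟩ := Set.exists_of_ssubset (hF.subset.ssubset_of_ne hne)
  have := (hF.isPolytope hP).finiteDimensional_vectorSpan
  obtain ⟨g, hg⟩ := (hF.isPolytope hP).vertices_nonempty
  have hgP : g ∈ vertices P := (hF.vertices_eq ▸ hg).2
  set K := vectorSpan ℝ F ⊔ ℝ ∙ (p₁ - g)
  have hK : finrank ℝ K < polyDim P := by
    have hle := Submodule.finrank_add_le_finrank_add_finrank (vectorSpan ℝ F) (ℝ ∙ (p₁ - g))
    have hp₁g : p₁ - g ≠ 0 := sub_ne_zero.mpr fun h => hp₁F (h ▸ hg.1)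
    rw [finrank_span_singleton hp₁g, ← polyDim_eq] at hle
    exact hle.trans_lt hdim
  obtain ⟨p₀, hp₀, hp₀K⟩ := hP.exists_vertex_sub_notMem hgP hK
  obtain ⟨d, hdK, hd⟩ := exists_mem_orthogonal_inner_pos hp₀K
  rw [inner_sub_right, sub_pos] at hd
  have inner_eq {q : E} (hq : q - g ∈ K) : ⟪d, q⟫ = ⟪d, g⟫ := by
    have hqg := hdK _ hq
    rwa [real_inner_comm, inner_sub_right, sub_eq_zero] at hqg
  have inner_eq_face {q : E} (hq : q ∈ F) : ⟪d, q⟫ = ⟪d, g⟫ :=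
    inner_eq (le_sup_left (a := vectorSpan ℝ F) (sub_mem_vectorSpan hq hg.1))
  have inner_p₁ : ⟪d, p₁⟫ = ⟪d, g⟫ :=
    inner_eq (le_sup_right (a := vectorSpan ℝ F) (Submodule.mem_span_singleton_self _))
  obtain ⟨c, rfl⟩ := hF
  obtain ⟨t, hgt, p, hpt, hpd⟩ := hP.exists_mem_maxFace_add_smul hg.1 hp₀.1 hd
  refine ⟨_, ⟨c + t • d, rfl⟩, fun h => hp₁F ?_, fun q hq => ?_, fun h => ?_⟩
  · have heq := inner_eq_of_mem_maxFace (h.symm ▸ hp₁ : p₁ ∈ maxFace P (c + t • d)) hgt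
    simp only [inner_add_left, real_inner_smul_left, inner_p₁, add_left_inj] at heq
    exact mem_maxFace_of_inner_le hg.1 hp₁ heq.ge
  · apply mem_maxFace_of_inner_le hgt hq.1
    simp only [inner_add_left, real_inner_smul_left, inner_eq_face hq,
      inner_eq_of_mem_maxFace hq hg.1, le_refl]
  · exact hpd.ne' (inner_eq_face (h hpt))

theorem IsFace.exists_isFacet_superset {F : Set E} (hF : IsFace P F) (hP : IsPolytope P)
    (hne : F ≠ P) : ∃ G, IsFacet P G ∧ F ⊆ G := by
  induction hn : polyDim P - polyDim F using Nat.strong_induction_on generalizing F with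
  | _ n ih =>
    have hlt := hF.polyDim_lt_of_ssubset (isFace_self P) hP (hF.subset.ssubset_of_ne hne)
    by_cases hdim : polyDim F + 1 < polyDim P
    · obtain ⟨G, hG, hGP, hFG⟩ := hF.exists_isFace_ssuperset hP hne hdim
      have := hF.polyDim_lt_of_ssubset hG hP hFG
      obtain ⟨H, hH, hGH⟩ := ih _ (by omega) hG hGP rfl
      exact ⟨H, hH, hFG.1.trans hGH⟩
    · exact ⟨F, ⟨hF, by omega⟩, subset_rfl⟩

namespace IsSimplex

variable {F : Set E}

theorem isPolytope (hF : IsSimplex F) : IsPolytope F := by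
  obtain ⟨s, hs, -, rfl⟩ := hF
  exact isPolytope_convexHull s.finite_toSet hs

theorem linearIndependent_sub (hF : IsSimplex F) {v : E} (hv : v ∈ vertices F) :
    LinearIndependent ℝ fun p : {p // p ∈ vertices F ∧ p ≠ v} => (p : E) - v := by
  obtain ⟨s, -, hs, rfl⟩ := hF
  have hsub : vertices (convexHull ℝ (s : Set E)) ⊆ s := extremePoints_convexHull_subset
  have hind := (affineIndependent_iff_linearIndependent_vsub ℝ _ (⟨v, hsub hv⟩ : s)).mp hs
  exact hind.comp (fun p : {p // p ∈ vertices (convexHull ℝ (s : Set E)) ∧ p ≠ v} =>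
    (⟨⟨p, hsub p.2.1⟩, fun h => p.2.2 (congrArg Subtype.val h)⟩ : {x : s // x ≠ ⟨v, hsub hv⟩}))
    fun p q h => Subtype.ext (congrArg (fun x => (x.1 : E)) h)

theorem linearIndependent_pair (hF : IsSimplex F) {v p q : E} (hv : v ∈ vertices F)
    (hp : p ∈ vertices F) (hq : q ∈ vertices F) (hpv : p ≠ v) (hqv : q ≠ v) (hpq : p ≠ q) :
    LinearIndependent ℝ ![p - v, q - v] := by
  have hinj : Function.Injective
      ![(⟨p, hp, hpv⟩ : {p // p ∈ vertices F ∧ p ≠ v}), ⟨q, hq, hqv⟩] :=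
    Fin.cons_injective_iff.mpr ⟨by simpa using hpq, Function.injective_of_subsingleton _⟩
  convert (hF.linearIndependent_sub hv).comp _ hinj using 1
  ext i
  fin_cases i <;> rfl

theorem isEdge (hF : IsSimplex F) {v w : E} (hv : v ∈ vertices F) (hw : w ∈ vertices F)
    (hvw : v ≠ w) : IsEdge F v w := by
  classical
  have : Finite {p // p ∈ vertices F ∧ p ≠ v} :=
    hF.isPolytope.finite_vertices.subset fun _ h => h.1
  obtain ⟨d, hd⟩ := exists_inner_eq_of_linearIndependent (hF.linearIndependent_sub hv)
    (fun p => if (p : E) = w then 0 else -1)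
  have inner_eq {p : E} (hp : p ∈ vertices F) (hpv : p ≠ v) :
      ⟪d, p⟫ - ⟪d, v⟫ = if p = w then 0 else -1 := by
    rw [← inner_sub_right]
    exact hd ⟨p, hp, hpv⟩
  refine ⟨hvw, hv, hw, d, hF.isPolytope.maxFace_eq_convexHull (Set.insert_nonempty v _)
    (Set.pair_subset hv hw) (r := ⟪d, v⟫) ?_ fun p hp hps => ?_⟩
  · rintro p (rfl | rfl)
    · rfl
    · rw [← sub_eq_zero, inner_eq hw hvw.symm, if_pos rfl]
  · rw [Set.mem_insert_iff, Set.mem_singleton_iff, not_or] at hps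
    rw [← sub_neg, inner_eq hp hps.1, if_neg hps.2]
    exact neg_one_lt_zero

end IsSimplex

theorem NormallyEquivalent.vertexMap_sub_eq_smul_of_isSimplex (h : NormallyEquivalent Q P)
    (hP : IsPolytope P) (hQ : IsPolytope Q) {F : Set E} (hF : IsFace P F) (hsimplex : IsSimplex F)
    {v a w : E} (hv : v ∈ vertices F) (ha : a ∈ vertices F) (hw : w ∈ vertices F) (hav : a ≠ v)
    (hwv : w ≠ v) (haw : a ≠ w) {l : ℝ}
    (hl : vertexMap P Q a - vertexMap P Q v = l • (a - v)) :
    vertexMap P Q w - vertexMap P Q v = l • (w - v) := by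
  have isEdge_of {p q : E} (hp : p ∈ vertices F) (hq : q ∈ vertices F) (hpq : p ≠ q) :
      IsEdge P p q := by
    obtain ⟨c, rfl⟩ := hF
    exact hP.isEdge_of_isEdge_maxFace (hsimplex.isEdge hp hq hpq)
  obtain ⟨m, -, hm⟩ := h.exists_vertexMap_sub hP hQ (isEdge_of hv hw hwv.symm)
  obtain ⟨k, -, hk⟩ := h.exists_vertexMap_sub hP hQ (isEdge_of ha hw haw)
  have hcycle : (l - k) • (a - v) + (k - m) • (w - v) = 0 := by
    have hsum : l • (a - v) + k • (w - a) - m • (w - v) = 0 := by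
      rw [← hl, ← hk, ← hm]
      abel
    rw [← hsum]
    module
  obtain ⟨hlk, hkm⟩ := LinearIndependent.pair_iff.mp
    (hsimplex.linearIndependent_pair hv ha hw hav hwv haw) _ _ hcycle
  rw [hm, ← sub_eq_zero.mp hkm, ← sub_eq_zero.mp hlk]

theorem IsEdge.figurePoint_mem_vertices {b v w : E} (hb : maxFace P b = {v})
    (hvw : IsEdge P v w) : figurePoint b v w ∈ vertices (vertexFigure P b v) := by
  obtain ⟨hne, -, hw, c, hc⟩ := hvw
  have hvc : v ∈ maxFace P c := hc ▸ subset_convexHull ℝ _ (by simp)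
  have hwc : w ∈ maxFace P c := hc ▸ subset_convexHull ℝ _ (by simp)
  refine mem_vertices_of_maxFace_eq (c := c) ?_
  rw [← convexHull_singleton (𝕜 := ℝ) (figurePoint b v w)]
  refine maxFace_convexHull (r := 0) (Set.singleton_nonempty _)
    (Set.singleton_subset_iff.mpr ⟨w, ⟨hw, hne.symm⟩, rfl⟩) ?_ ?_
  · rintro p rfl
    have hinner := inner_sub_eq_mul_inner_figurePoint hb hw.1 hne.symm c
    rw [inner_eq_of_mem_maxFace hwc hvc, sub_self, eq_comm, mul_eq_zero] at hinner
    exact hinner.resolve_left (inner_sub_pos_of_maxFace_eq hb hw.1 hne.symm).ne'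
  · rintro _ ⟨p, ⟨hp, hpv⟩, rfl⟩ hpw
    have hpc : p ∉ maxFace P c := fun hpc => by
      have hp' : p ∈ vertices (maxFace P c) := vertices_maxFace P c ▸ ⟨hpc, hp⟩
      rw [hc] at hp'
      rcases extremePoints_convexHull_subset hp' with h | h
      · exact hpv h
      · exact hpw (congrArg _ h)
    have hlt := sub_neg.mpr (inner_lt_of_notMem_maxFace hvc hp.1 hpc)
    rw [inner_sub_eq_mul_inner_figurePoint hb hp.1 hpv] at hlt
    exact neg_of_mul_neg_right hlt (inner_sub_pos_of_maxFace_eq hb hp.1 hpv).le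

theorem IsPolytope.exists_isFacet_of_isEdge_vertexFigure (hP : IsPolytope P)
    (hdim : 3 ≤ polyDim P) {b v p q : E} (hb : maxFace P b = {v}) (hp : p ∈ vertices P)
    (hq : q ∈ vertices P) (hpv : p ≠ v) (hqv : q ≠ v)
    (h : IsEdge (vertexFigure P b v) (figurePoint b v p) (figurePoint b v q)) :
    ∃ F, IsFacet P F ∧ v ∈ F ∧ p ∈ F ∧ q ∈ F := by
  classical
  have hv := mem_vertices_of_maxFace_eq hb
  obtain ⟨-, -, -, f, hf⟩ := h
  have hpf : figurePoint b v p ∈ maxFace (vertexFigure P b v) f :=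
    hf ▸ subset_convexHull ℝ _ (by simp)
  have hqf : figurePoint b v q ∈ maxFace (vertexFigure P b v) f :=
    hf ▸ subset_convexHull ℝ _ (by simp)
  set c := f + ⟪f, figurePoint b v p⟫ • b
  have hc := hP.maxFace_add_smul_of_mem_vertexFigure hb hpf
  have hne : maxFace P c ≠ P := fun hcP => by
    have hle : vectorSpan ℝ P ≤ Submodule.span ℝ {figurePoint b v p, figurePoint b v q} := by
      refine hP.vectorSpan_le hv fun u hu => ?_
      rw [← hcP, hc] at hu
      rcases extremePoints_convexHull_subset hu with rfl | ⟨hu, huv, huf⟩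
      · rw [sub_self]
        exact zero_mem _
      · rw [← smul_figurePoint hb hu.1 huv]
        rw [hf] at huf
        exact Submodule.smul_mem _ _
          (convexHull_min Submodule.subset_span (Submodule.convex _) huf)
    have hspan := finrank_span_finset_le_card (R := ℝ) {figurePoint b v p, figurePoint b v q}
    rw [Finset.coe_pair, Set.finrank] at hspan
    have : FiniteDimensional ℝ (Submodule.span ℝ {figurePoint b v p, figurePoint b v q}) :=
      FiniteDimensional.span_of_finite ℝ (Set.toFinite _)
    have := Submodule.finrank_mono hle
    have := Finset.card_le_two (a := figurePoint b v p) (b := figurePoint b v q)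
    rw [polyDim_eq] at hdim
    omega
  obtain ⟨F, hF, hcF⟩ := IsFace.exists_isFacet_superset ⟨c, rfl⟩ hP hne
  rw [hc] at hcF
  have hsub := (subset_convexHull ℝ _).trans hcF
  exact ⟨F, hF, hsub (.inl rfl), hsub (.inr ⟨hp, hpv, hpf⟩), hsub (.inr ⟨hq, hqv, hqf⟩)⟩

namespace IsSimplicial

theorem exists_forall_vertexMap_sub (hs : IsSimplicial P) (hP : IsPolytope P)
    (hdim : 3 ≤ polyDim P) (hQ : IsPolytope Q) (h : NormallyEquivalent Q P) {v : E}
    (hv : v ∈ vertices P) : ∃ l : ℝ, ∀ w, IsEdge P v w →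
      vertexMap P Q w - vertexMap P Q v = l • (w - v) := by
  by_cases hex : ∃ w, IsEdge P v w
  swap
  · exact ⟨0, fun w hw => absurd ⟨w, hw⟩ hex⟩
  obtain ⟨w₀, hw₀⟩ := hex
  obtain ⟨b, hb⟩ := hP.exists_maxFace_eq_singleton hv
  obtain ⟨l, -, hl⟩ := h.exists_vertexMap_sub hP hQ hw₀
  refine ⟨l, fun w hw => (hP.isPolytope_vertexFigure b hw₀.2.2.1 hw₀.1.symm).induction_on_edges
    (S := fun q => ∀ w ∈ vertices P, w ≠ v → figurePoint b v w = q →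
      vertexMap P Q w - vertexMap P Q v = l • (w - v))
    (hw₀.figurePoint_mem_vertices hb) ?_ ?_ (hw.figurePoint_mem_vertices hb)
    w hw.2.2.1 hw.1.symm rfl⟩
  · intro w hw hwv heq
    rwa [figurePoint_injOn hb ⟨hw, hwv⟩ ⟨hw₀.2.2.1, hw₀.1.symm⟩ heq]
  · rintro q _ hedge hS w hw hwv rfl
    obtain ⟨a, ha, hav, rfl⟩ := exists_figurePoint_eq hedge.2.1
    obtain ⟨F, hF, hvF, haF, hwF⟩ :=
      hP.exists_isFacet_of_isEdge_vertexFigure hdim hb ha hw hav hwv hedge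
    have mem_vertices {p : E} (hp : p ∈ vertices P) (hpF : p ∈ F) : p ∈ vertices F :=
      hF.1.vertices_eq ▸ ⟨hpF, hp⟩
    exact h.vertexMap_sub_eq_smul_of_isSimplex hP hQ hF.1 (hs F hF) (mem_vertices hv hvF)
      (mem_vertices ha haF) (mem_vertices hw hwF) hav hwv (fun haw => hedge.1 (haw ▸ rfl))
      (hS a ha hav rfl)

theorem exists_vertexMap_eq (hs : IsSimplicial P) (hP : IsPolytope P)
    (hdim : 3 ≤ polyDim P) (hQ : IsPolytope Q) (h : NormallyEquivalent Q P) :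
    ∃ (l : ℝ) (t : E), ∀ v ∈ vertices P, vertexMap P Q v = l • v + t := by
  choose! l hl using fun v hv => hs.exists_forall_vertexMap_sub hP hdim hQ h (v := v) hv
  obtain ⟨v₀, hv₀⟩ := hP.vertices_nonempty
  have ratio_eq {v w : E} (hvw : IsEdge P v w) : l w = l v := by
    have hsub := hl v hvw.2.1 w hvw
    rw [← neg_sub, hl w hvw.2.2.1 v hvw.symm, ← smul_neg, neg_sub] at hsub
    exact smul_left_injective ℝ (sub_ne_zero.mpr hvw.1.symm) hsub
  refine ⟨l v₀, vertexMap P Q v₀ - l v₀ • v₀, fun v hv => ?_⟩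
  refine (hP.induction_on_edges (S := fun v => l v = l v₀ ∧
    vertexMap P Q v = l v₀ • v + (vertexMap P Q v₀ - l v₀ • v₀)) hv₀ ⟨rfl, by abel⟩ ?_ hv).2
  rintro v w hvw ⟨hlv, hv⟩
  refine ⟨(ratio_eq hvw).trans hlv, ?_⟩
  rw [sub_eq_iff_eq_add.mp (hl v hvw.2.1 w hvw), hlv, hv, smul_sub]
  abel

theorem inCone_subset (hs : IsSimplicial P) (hP : IsPolytope P) (hdim : 3 ≤ polyDim P) :
    inCone P ⊆ ℝ ∙ translationClass P := by
  rintro _ ⟨Q, hQ, -, h, rfl⟩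
  obtain ⟨l, t, hlt⟩ := hs.exists_vertexMap_eq hP hdim hQ h
  refine Submodule.mem_span_singleton.mpr ⟨l, (Submodule.Quotient.eq _).mpr ⟨-t, ?_⟩⟩
  ext c
  simp [h.supportFun_eq hP hQ, hlt _ (hP.topVertex_mem c).2, inner_add_right,
    supportFun_eq (hP.topVertex_mem c).1, real_inner_smul_right]

theorem inConeDim_le_one (hs : IsSimplicial P) (hP : IsPolytope P) (hdim : 3 ≤ polyDim P) :
    inConeDim P ≤ 1 :=
  (rank_submodule_le_one_iff' _).mpr
    ⟨translationClass P, Submodule.span_le.mpr (hs.inCone_subset hP hdim)⟩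

end IsSimplicial

theorem mainTheorem10_general (hP : IsPolytope P) :
    (3 ≤ polyDim P → IsSimplicial P → inConeDim P ≤ 1) ∧
    ((∃ F, IsOddTwoFace P F) → inConeDim P ≤ (polyDim P - 1 : ℕ)) ∧
    ((∃ F₁ F₂, IsOddTwoFace P F₁ ∧ IsOddTwoFace P F₂ ∧ IsFaceOfDim P 1 (F₁ ∩ F₂)) →
      inConeDim P ≤ (polyDim P - 2 : ℕ) ∧
      (polyDim P = 3 → (NormallyInscribable P → inConeDim P = 1) ∧
        ∀ Q Q' : Set E,
          IsPolytope Q → IsInscribed Q → normalFan Q = normalFan P →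
          IsPolytope Q' → IsInscribed Q' → normalFan Q' = normalFan P →
          ∃ (a : ℝ) (t : E), 0 < a ∧ Q' = (fun x => a • x + t) '' Q)) := by
  refine ⟨fun hdim hs => hs.inConeDim_le_one hP hdim,
    fun ⟨F, hF⟩ => hP.inConeDim_le_of_isOddTwoFace hF, fun ⟨F₁, F₂, hF₁, hF₂, hF⟩ => ?_⟩
  have hle := hP.inConeDim_le_of_adjacent hF₁ hF₂ hF
  refine ⟨hle, fun hdim => ?_⟩
  have hpos : 0 < polyDim P := by omega
  rw [hdim, Nat.cast_one] at hle
  refine ⟨fun hI => hle.antisymm (hP.one_le_inConeDim hpos hI), ?_⟩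
  intro Q Q' hQ hIQ hQP hQ' hIQ' hQ'P
  exact hP.exists_homothety hpos hle hQ hIQ (hP.normallyEquivalent_of_normalFan_eq hQ hQP)
    hQ' hIQ' (hP.normallyEquivalent_of_normalFan_eq hQ' hQ'P)

end InscribedCone

end

theorem mainTheorem10 (n : ℕ) :
    (∀ (d : ℕ) (P : Set (EuclideanSpace ℝ (Fin n))), 3 ≤ d → IsPolytope P → polyDim P = d →
      IsSimplicial P → inConeDim P ≤ 1) ∧
    (∀ P : Set (EuclideanSpace ℝ (Fin n)), IsPolytope P → polyDim P = 3 →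
      NormallyInscribable P →
      ((∃ F, IsOddTwoFace P F) → inConeDim P ≤ 2) ∧
      ((∃ F₁ F₂, IsOddTwoFace P F₁ ∧ IsOddTwoFace P F₂ ∧ IsFaceOfDim P 1 (F₁ ∩ F₂)) →
        inConeDim P = 1 ∧
        ∀ Q Q' : Set (EuclideanSpace ℝ (Fin n)),
          IsPolytope Q → IsInscribed Q → normalFan Q = normalFan P →
          IsPolytope Q' → IsInscribed Q' → normalFan Q' = normalFan P →
          ∃ (a : ℝ) (t : EuclideanSpace ℝ (Fin n)), 0 < a ∧ Q' = (fun x => a • x + t) '' Q)) := by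
  refine ⟨fun d P hd hP hdim => (mainTheorem10_general hP).1 (hdim ▸ hd), fun P hP hdim hI => ?_⟩
  obtain ⟨-, hodd, hadj⟩ := mainTheorem10_general hP
  exact ⟨by simpa only [hdim, Nat.reduceSub, Nat.cast_ofNat] using hodd,
    fun h => ((hadj h).2 hdim).imp_left (· hI)⟩
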